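/- **Setting.** Let $V$ be a finite-dimensional real inner product space, $\langle\cdot,\cdot\rangle$ its scalar product extended complex-bilinearly to $V+\mathrm iV$, and $D\subseteq V$ closed and convex. Fix a horizon $\mathbb T<\infty$ and a filtered probability space $(\Omega,\mathcal F,(\mathcal F_t),\mathbb Q)$; $\mathbb E$ is expectation under $\mathbb Q$. Let $X=(X_t)_{0\le t\le\mathbb T}$ be an adapted, time-homogeneous, conservative Markov process in $D$ with transition kernels $(p_t)$ and initial value $X_0=x_0$ in the interior of $D$. Put $\mathfrak U_t:=\{\zeta\in V+\mathrm iV:\ \mathbb E[|e^{\langle\zeta,X_s\rangle}|]<\infty\ \text{for all } s\in[0,t]\}$. Assume that $X$ is affine: $t\mapsto p_t(x,\cdot)$ is weakly continuous for every $x\in D$, and there are functions $\phi$ (complex valued) and $\psi$ (with values in $V+\mathrm iV$) such that $$\int_D e^{\langle u,\xi\rangle}p_t(x,d\xi)=e^{\phi(t,u)+\langle\psi(t,u),x\rangle}\qquad\text{for all } x\in D,\ t\in[0,\mathbb T],\ u\in\mathfrak U_t,$$ where, as usual, $\phi(t,u)$ is chosen real for real $u\in\mathfrak U_t\cap V$.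 Let $0<\delta_1<\dots<\delta_m$ be tenors, $B(t,T)$ the prices of OIS zero-coupon bonds, with $B(T,T)=1$, and $L_t(t,t+\delta_j)$ the ($\mathcal F_t$-measurable) spot Xibor rates. Let $(B,\mathbb Q)$ be a numéraire–martingale measure couple: $B=(B_t)$ is strictly positive and adapted, $B_0=1$, and the $B$-discounted prices of all OIS bonds and of all forward rate agreements (paying $\delta_j(L_T(T,T+\delta_j)-K)$ at $T+\delta_j$) are $\mathbb Q$-martingales up to maturity. The spot multiplicative spreads are $$S^{\delta_j}(t,t)=\frac{1+\delta_jL_t(t,t+\delta_j)}{1+\delta_jL^{\mathrm{OIS}}_t(t,t+\delta_j)},\qquad L^{\mathrm{OIS}}_t(t,t+\delta_j)=\frac1{\delta_j}\Bigl(\frac1{B(t,t+\delta_j)}-1\Bigr).$$ Let $(X,\mathbf u,\mathbf v)$ be an affine multi-curve model: $u_0,\dots,u_m:[0,\mathbb T]\to V$ and $v_0,\dots,v_m:[0,\mathbb T]\to\mathbb R$ satisfy $u_0(t)\in\mathfrak U_t$, $u_j(t)+u_0(t)\in\mathfrak U_t$ and, almost surely, $\log B_t=-v_0(t)-\langle u_0(t),X_t\rangle$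 for $t\in[0,\mathbb T]$, and $S^{\delta_j}(t,t)>0$ with $\log S^{\delta_j}(t,t)=v_j(t)+\langle u_j(t),X_t\rangle$ for $t+\delta_j\le\mathbb T$, $j=1,\dots,m$. Fix $i\in\{1,\dots,m\}$, $0\le t\le T$ with $T+\delta_i\le\mathbb T$, $N,K,\epsilon\in\mathbb R$ with $\bar K:=1+\delta_iK>0$, and put $\mathcal Y_T:=\log\bigl(S^{\delta_i}(T,T)/B(T,T+\delta_i)\bigr)$, $$\mathcal A_{\mathcal Y_T}:=\Bigl\{\nu\in\mathbb R:\ \mathbb E\Bigl[\frac{B(T,T+\delta_i)}{B_T}e^{\nu\mathcal Y_T}\Bigr]<\infty\Bigr\}^{\circ}$$ (the interior), and, with $w(\zeta):=(1-\mathrm i\zeta)\,\psi(\delta_i,u_0(T+\delta_i))+\mathrm i\zeta\,(u_i(T)+u_0(T))$, $$\varphi_{\mathcal Y_T}(\zeta):=\exp\Bigl((1-\mathrm i\zeta)\bigl(v_0(T+\delta_i)+\phi(\delta_i,u_0(T+\delta_i))\bigr)+\mathrm i\zeta\bigl(v_i(T)+v_0(T)\bigr)+\phi(T-t,w(\zeta))+\langle\psi(T-t,w(\zeta)),X_t\rangle\Bigr).$$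 **Proposition.** Assume $1+\epsilon\in\mathcal A_{\mathcal Y_T}$. Then: 1. For every $\zeta\in\mathbb C$ with $-\Im\zeta\in\mathcal A_{\mathcal Y_T}$, and also for $\zeta=0$ and $\zeta=-\mathrm i$, the random variable $\frac{B(T,T+\delta_i)}{B_T}e^{\mathrm i\zeta\mathcal Y_T}$ is integrable and, almost surely, $$\varphi_{\mathcal Y_T}(\zeta)=\mathbb E\Bigl[\frac{B(T,T+\delta_i)}{B_T}e^{\mathrm i\zeta\mathcal Y_T}\Bigm|\mathcal F_t\Bigr].$$ 2. The discounted caplet payoff is integrable, and the price at date $t$ of the caplet with notional $N$, reset date $T$ and payoff $N\delta_i(L_T(T,T+\delta_i)-K)^+$ at the settlement date $T+\delta_i$, $$\Pi^{CPLT}(t;T,T+\delta_i,K,N):=NB_t\,\mathbb E\Bigl[\frac{\delta_i}{B_{T+\delta_i}}\bigl(L_T(T,T+\delta_i)-K\bigr)^+\Bigm|\mathcal F_t\Bigr],$$ is almost surely equal to $$NB_t\left(R(\mathcal Y,\bar K,\epsilon)+\frac1\pi\int_{0-\mathrm i\epsilon}^{\infty-\mathrm i\epsilon}\Re\left(e^{-\mathrm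 i\zeta\log\bar K}\,\frac{\varphi_{\mathcal Y_T}(\zeta-\mathrm i)}{-\zeta(\zeta-\mathrm i)}\right)d\zeta\right).$$ Here the integral is taken along $\zeta=x-\mathrm i\epsilon$, $x\in(0,\infty)$, and converges absolutely almost surely; $\varphi_{\mathcal Y_T}(-\mathrm i)$ and $\varphi_{\mathcal Y_T}(0)$ are almost surely real; and $$R(\mathcal Y,\bar K,\epsilon)=\begin{cases}\varphi_{\mathcal Y_T}(-\mathrm i)-\bar K\varphi_{\mathcal Y_T}(0),&\epsilon<-1,\\ \varphi_{\mathcal Y_T}(-\mathrm i)-\tfrac{\bar K}2\varphi_{\mathcal Y_T}(0),&\epsilon=-1,\\ \varphi_{\mathcal Y_T}(-\mathrm i),&-1<\epsilon<0,\\ \tfrac12\varphi_{\mathcal Y_T}(-\mathrm i),&\epsilon=0,\\ 0,&\epsilon>0.\end{cases}$$ -/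

import Mathlib

open MeasureTheory ProbabilityTheory Filter Topology
open scoped NNReal

namespace MultiCurve

/-! ### The complexification `V + iV` -/

/-- An element `re + i im` of the complexification `V + iV` of a real vector space `V`. -/
structure CVec (V : Type*) where
  /-- real part -/
  re : V
  /-- imaginary part -/
  im : V

namespace CVec

variable {V : Type*} [NormedAddCommGroup V] [InnerProductSpace ℝ V]

/-- A real vector seen as an element of `V + iV`. -/
def ofReal (v : V) : CVec V := ⟨v, 0⟩

/-- Addition in `V + iV`. -/
instance : Add (CVec V) := ⟨fun a b => ⟨a.re + b.re, a.im + b.im⟩⟩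

/-- Multiplication of an element of `V + iV` by a complex number. -/
noncomputable instance : SMul ℂ (CVec V) :=
  ⟨fun c a => ⟨c.re • a.re - c.im • a.im, c.re • a.im + c.im • a.re⟩⟩

/-- The pairing `⟨ζ, x⟩ = ⟨Re ζ, x⟩ + i ⟨Im ζ, x⟩` of `ζ ∈ V + iV` with a real vector `x`
(the complex bilinear extension of the scalar product of `V`). -/
noncomputable def pair (a : CVec V) (x : V) : ℂ :=
  ((inner ℝ a.re x : ℝ) : ℂ) + Complex.I * ((inner ℝ a.im x : ℝ) : ℂ)

end CVec

/-! ### Affine processes -/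

section Affine

variable {Ω : Type*} {mΩ : MeasurableSpace Ω}
variable {V : Type*} [NormedAddCommGroup V] [InnerProductSpace ℝ V] [MeasurableSpace V]
variable {D : Set V}

/-- `X` is, on the time interval `[0, H]`, an adapted, time-homogeneous, conservative Markov
process with state space `D`, initial value `x₀` and transition kernels `p`. -/
structure IsMarkovProcess (H : ℝ≥0) (ℱ : Filtration ℝ≥0 mΩ) (Q : Measure Ω)
    (X : ℝ≥0 → Ω → D) (p : ℝ≥0 → Kernel D D) (x₀ : D) : Prop where
  adapted : ∀ t ≤ H, Measurable[ℱ t] (X t)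
  initial : ∀ᵐ ω ∂Q, X 0 ω = x₀
  conservative : ∀ t ≤ H, IsMarkovKernel (p t)
  kernel_zero : p 0 = Kernel.id
  chapman_kolmogorov : ∀ s t : ℝ≥0, s + t ≤ H → p (s + t) = (p t) ∘ₖ (p s)
  markov : ∀ s t : ℝ≥0, s + t ≤ H → ∀ A : Set D, MeasurableSet A →
    Q[(X (s + t) ⁻¹' A).indicator (fun _ => (1 : ℝ)) | ℱ s] =ᵐ[Q]
      fun ω => (p t (X s ω)).real A

/-- The set `𝔘_T` of all `ζ ∈ V + iV` such that `e^{⟨ζ, X_t⟩}` has a finite expectation for every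
`t ∈ [0, T]`. -/
def expDomain (Q : Measure Ω) (X : ℝ≥0 → Ω → D) (T : ℝ≥0) : Set (CVec V) :=
  {ζ | ∀ t ≤ T, Integrable (fun ω => Complex.exp (ζ.pair (X t ω : V))) Q}

/-- `X` is an affine process on `[0, H]` with characteristic exponents `φ` and `ψ`.
The exponents matter only on `{(t, u) | t ≤ H, u ∈ 𝔘_t}`.
Since the exponent `φ + ⟨ψ, x⟩` is only determined up to multiples of `2πi`, the
usual convention is made that `φ(t, u)` is real when the argument `u` is real. -/
structure IsAffineProcess (H : ℝ≥0) (ℱ : Filtration ℝ≥0 mΩ) (Q : Measure Ω)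
    (X : ℝ≥0 → Ω → D) (p : ℝ≥0 → Kernel D D) (x₀ : D)
    (φ : ℝ≥0 → CVec V → ℂ) (ψ : ℝ≥0 → CVec V → CVec V) : Prop
    extends IsMarkovProcess H ℱ Q X p x₀ where
  stochastically_continuous : ∀ t ≤ H, ∀ x : D, ∀ f : BoundedContinuousFunction D ℝ,
    Tendsto (fun s => ∫ ξ, f ξ ∂(p s x)) (𝓝[Set.Iic H] t) (𝓝 (∫ ξ, f ξ ∂(p t x)))
  affine : ∀ t ≤ H, ∀ u ∈ expDomain Q X t, ∀ x : D,
    Integrable (fun ξ : D => Complex.exp (u.pair (ξ : V))) (p t x) ∧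
    ∫ ξ : D, Complex.exp (u.pair (ξ : V)) ∂(p t x) =
      Complex.exp (φ t u + (ψ t u).pair (x : V))
  real_exponent : ∀ t ≤ H, ∀ w : V, CVec.ofReal w ∈ expDomain Q X t →
    (φ t (CVec.ofReal w)).im = 0

end Affine

/-! ### The market -/

section Market

variable {Ω : Type*} {mΩ : MeasurableSpace Ω} {m : ℕ}

/-- The quantities quoted in the market with time horizon `H` and tenors `δ`:
OIS zero-coupon bond prices `bond t T = B(t, T)`, spot Xibor rates
`xibor i t = L_t(t, t + δ_i)`, and the prices `fra i T K t` at time `t` of the forward rate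
agreements for the period `[T, T + δ_i]` with rate `K` and unit notional. -/
structure Market (H : ℝ≥0) (δ : Fin m → ℝ≥0) (ℱ : Filtration ℝ≥0 mΩ) where
  /-- OIS bond prices -/
  bond : ℝ≥0 → ℝ≥0 → Ω → ℝ
  /-- spot Xibor rates -/
  xibor : Fin m → ℝ≥0 → Ω → ℝ
  /-- prices of forward rate agreements -/
  fra : Fin m → ℝ≥0 → ℝ → ℝ≥0 → Ω → ℝ
  bond_maturity : ∀ T ≤ H, ∀ ω, bond T T ω = 1
  xibor_adapted : ∀ i t, t + δ i ≤ H → Measurable[ℱ t] (xibor i t)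
  fra_maturity : ∀ i T K, T + δ i ≤ H → ∀ ω,
    fra i T K (T + δ i) ω = (δ i : ℝ) * (xibor i T ω - K)

namespace Market

variable {H : ℝ≥0} {δ : Fin m → ℝ≥0} {ℱ : Filtration ℝ≥0 mΩ}

/-- The simply compounded OIS spot rate
`L^{OIS}_t(t, t + δ_i) = (1 / B(t, t + δ_i) - 1) / δ_i`. -/
noncomputable def oisRate (M : Market H δ ℱ) (i : Fin m) (t : ℝ≥0) (ω : Ω) : ℝ :=
  1 / (δ i : ℝ) * (1 / M.bond t (t + δ i) ω - 1)

/-- The spot multiplicative spread `S^{δ_i}(t, t)`. -/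
noncomputable def spread (M : Market H δ ℱ) (i : Fin m) (t : ℝ≥0) (ω : Ω) : ℝ :=
  (1 + (δ i : ℝ) * M.xibor i t ω) / (1 + (δ i : ℝ) * M.oisRate i t ω)

/-- `(B, Q)` is a numéraire - martingale measure couple: `B` is adapted and strictly positive on
`[0, H]` with `B₀ = 1`, and the `B`-discounted price of every OIS bond and of every
forward rate agreement is a `Q`-martingale up to the maturity of the contract. -/
structure IsNumeraireCouple (M : Market H δ ℱ) (B : ℝ≥0 → Ω → ℝ) (Q : Measure Ω) : Prop where
  adapted : ∀ t ≤ H, Measurable[ℱ t] (B t)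
  pos : ∀ t ≤ H, ∀ ω, 0 < B t ω
  initial : ∀ ω, B 0 ω = 1
  bond_martingale : ∀ T ≤ H,
    Martingale (fun t ω => M.bond (min t T) T ω / B (min t T) ω) ℱ Q
  fra_martingale : ∀ i T K, T + δ i ≤ H → 0 < K →
    Martingale (fun t ω => M.fra i T K (min t (T + δ i)) ω / B (min t (T + δ i)) ω) ℱ Q

variable {V : Type*} [NormedAddCommGroup V] [InnerProductSpace ℝ V] {D : Set V}

/-- `(X, u, v)` is an affine multi-curve model for the market `M` with numéraire `B`; the families
`u = (u₀, …, u_m)` and `v = (v₀, …, v_m)` are indexed by `Fin (m + 1)`. -/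
structure IsAffineMultiCurve (M : Market H δ ℱ) (B : ℝ≥0 → Ω → ℝ) (Q : Measure Ω)
    (X : ℝ≥0 → Ω → D) (u : Fin (m + 1) → ℝ≥0 → V) (v : Fin (m + 1) → ℝ≥0 → ℝ) : Prop where
  u_zero_mem : ∀ t ≤ H, CVec.ofReal (u 0 t) ∈ expDomain Q X t
  u_add_mem : ∀ i : Fin m, ∀ t ≤ H, CVec.ofReal (u i.succ t + u 0 t) ∈ expDomain Q X t
  log_numeraire : ∀ t ≤ H, ∀ᵐ ω ∂Q,
    Real.log (B t ω) = -v 0 t - inner ℝ (u 0 t) (X t ω : V)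
  log_spread : ∀ (i : Fin m) (t : ℝ≥0), t + δ i ≤ H → ∀ᵐ ω ∂Q,
    0 < M.spread i t ω ∧
      Real.log (M.spread i t ω) = v i.succ t + inner ℝ (u i.succ t) (X t ω : V)

/-! ### Caplets -/

/-- The discounted payoff, per unit of notional, of the caplet with strike `K`, reset date `T` and
settlement date `T + δ_i`. -/
noncomputable def capletPayoff (M : Market H δ ℱ) (B : ℝ≥0 → Ω → ℝ) (i : Fin m) (T : ℝ≥0) (K : ℝ)
    (ω : Ω) : ℝ :=
  1 / B (T + δ i) ω * ((δ i : ℝ) * max (M.xibor i T ω - K) 0)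

/-- The price `Π^{CPLT}(t; T, T + δ_i, K, N)` at date `t` of the caplet with notional `N`:
`N B_t E[δ_i (L_T(T, T + δ_i) - K)⁺ / B_{T + δ_i} | ℱ_t]`. -/
noncomputable def capletPrice (M : Market H δ ℱ) (B : ℝ≥0 → Ω → ℝ) (Q : Measure Ω) (i : Fin m)
    (t T : ℝ≥0) (K N : ℝ) (ω : Ω) : ℝ :=
  N * B t ω * (Q[M.capletPayoff B i T K | ℱ t]) ω

/-- The random variable `𝒴_t = log (S^{δ_i}(t, t) / B(t, T + δ_i))` at `t = T`. -/
noncomputable def logRatio (M : Market H δ ℱ) (i : Fin m) (T : ℝ≥0) (ω : Ω) : ℝ :=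
  Real.log (M.spread i T ω / M.bond T (T + δ i) ω)

/-- The open set `𝒜_{𝒴_T}`: the interior of the set of all real `ν` such that
`E[B(T, T + δ_i) / B_T * e^{ν 𝒴_T}] < ∞`. -/
noncomputable def momentSet (M : Market H δ ℱ) (B : ℝ≥0 → Ω → ℝ) (Q : Measure Ω) (i : Fin m)
    (T : ℝ≥0) : Set ℝ :=
  interior {ν : ℝ | Integrable
    (fun ω => M.bond T (T + δ i) ω / B T ω * Real.exp (ν * M.logRatio i T ω)) Q}

/-- The random variable `B(T, T + δ_i) / B_T * e^{i ζ 𝒴_T}`. -/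
noncomputable def weightedExp (M : Market H δ ℱ) (B : ℝ≥0 → Ω → ℝ) (i : Fin m)
    (T : ℝ≥0) (ζ : ℂ) (ω : Ω) : ℂ :=
  ((M.bond T (T + δ i) ω / B T ω : ℝ) : ℂ) *
    Complex.exp (Complex.I * ζ * (M.logRatio i T ω : ℂ))

end Market

/-- The explicit expression of the modified moment generating function of `𝒴_T`, where `d` is the
tenor, `u₀`, `v₀` and `uᵢ`, `vᵢ` are the functions of the model, and `x` is the value of `X_t`. -/
noncomputable def modifiedMGF {V : Type*} [NormedAddCommGroup V] [InnerProductSpace ℝ V]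
    (φ : ℝ≥0 → CVec V → ℂ) (ψ : ℝ≥0 → CVec V → CVec V)
    (u₀ uᵢ : ℝ≥0 → V) (v₀ vᵢ : ℝ≥0 → ℝ) (d t T : ℝ≥0) (x : V) (ζ : ℂ) : ℂ :=
  let w : CVec V := (1 - Complex.I * ζ) • ψ d (CVec.ofReal (u₀ (T + d))) +
    (Complex.I * ζ) • CVec.ofReal (uᵢ T + u₀ T)
  Complex.exp ((1 - Complex.I * ζ) * ((v₀ (T + d) : ℂ) + φ d (CVec.ofReal (u₀ (T + d)))) +
      Complex.I * ζ * ((vᵢ T + v₀ T : ℝ) : ℂ)) *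
    Complex.exp (φ (T - t) w) * Complex.exp ((ψ (T - t) w).pair x)

/-- The residue term `R(𝒴, k, ε)` for a modified moment generating function `F`. (The values of `F`
at `0` and `-i` are real in the case of interest, so real parts are taken.) -/
noncomputable def residueTerm (F : ℂ → ℂ) (k ε : ℝ) : ℝ :=
  if ε < -1 then (F (-Complex.I)).re - k * (F 0).re
  else if ε = -1 then (F (-Complex.I)).re - k / 2 * (F 0).re
  else if ε < 0 then (F (-Complex.I)).re
  else if ε = 0 then 1 / 2 * (F (-Complex.I)).re
  else 0

/-- The integrand `Re (e^{-i ζ log k} F(ζ - i) / (-ζ (ζ - i)))`. -/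
noncomputable def fourierIntegrand (F : ℂ → ℂ) (k : ℝ) (ζ : ℂ) : ℝ :=
  (Complex.exp (-Complex.I * ζ * (Real.log k : ℂ)) *
    (F (ζ - Complex.I) / (-ζ * (ζ - Complex.I)))).re

end Market

end MultiCurve

/-! By the Markov property the conditional law of `X T` given `ℱ t` is `p (T - t) (X t ω)`. The
discounted bond is the exponential `W` of an affine function of `X T`, and 𝒴_T is an affine function
`Y` of it (`bond_div_eq`, `logRatio_eq`). Since 1 + δL = e^𝒴, conditioning first at `T` turns the
caplet into the integral of W (e^Y - K̄)⁺ under that kernel.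

With z = ε + ix = iζ, the payoff (e^y - 1)⁺ is a residue term plus 1/π times the half-line integral
of Re (e^{(z+1)y} / (z(z+1))), see `integral_payoffKernel`. Off the poles this is Fourier inversion
of a two-sided exponential. For ε = 0 or ε = -1 a pole lies on the line, but the real part only
retains the bounded quotient sin(xy)/x. Fubini (`integral_mul_max_exp_sub`) then carries the state
integral inside, where it becomes the modified moment generating function. In the pole cases the
majorant grows like |y|, which is absorbed because the moment set is open.

The affine transform formula needs its argument in 𝔘_{T-t}, hence moments at all earlier times,
whereas the moment set only controls time `T`. `expMoment_ne_top_of_le` closes this gap.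
Characteristic functions show that p_s(a) * p_s(b) depends only on a + b, so a moment that is finite
from one interior starting point is finite from all of them. Chapman–Kolmogorov then carries
finiteness backwards in steps so short that the process started at x₀ charges the interior of `D`.
-/

namespace MultiCurve

open Complex Set
open scoped FourierTransform

/-! ### Fourier inversion for the two-sided exponential. -/

/-- The two-sided exponential function `e^{-cy}` for `y ≤ 0` and `e^{-by}` for `y ≥ 0`
(when `c < 0 < b`). -/
noncomputable def twoSidedExp (c b y : ℝ) : ℝ := Real.exp (min (-c * y) (-b * y))

lemma twoSidedExp_of_nonneg {c b y : ℝ} (hcb : c ≤ b) (hy : 0 ≤ y) :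
    twoSidedExp c b y = Real.exp (-b * y) := by
  rw [twoSidedExp, min_eq_right]; nlinarith

lemma twoSidedExp_of_nonpos {c b y : ℝ} (hcb : c ≤ b) (hy : y ≤ 0) :
    twoSidedExp c b y = Real.exp (-c * y) := by
  rw [twoSidedExp, min_eq_left]; nlinarith

lemma continuous_twoSidedExp (c b : ℝ) : Continuous (twoSidedExp c b) := by
  unfold twoSidedExp; fun_prop

lemma integrable_twoSidedExp {c b : ℝ} (hc : c < 0) (hb : 0 < b) :
    Integrable (twoSidedExp c b) := by
  rw [← integrableOn_univ, ← Iic_union_Ioi (a := (0 : ℝ))]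
  refine IntegrableOn.union ?_ ?_
  · refine (integrableOn_exp_mul_Iic (a := -c) (by linarith) 0).congr_fun ?_ measurableSet_Iic
    intro y hy
    exact (twoSidedExp_of_nonpos (by linarith) hy).symm
  · refine (integrableOn_exp_mul_Ioi (a := -b) (by linarith) 0).congr_fun ?_ measurableSet_Ioi
    intro y hy
    exact (twoSidedExp_of_nonneg (by linarith) (le_of_lt hy)).symm

lemma add_ofReal_mul_I_ne_zero {a : ℝ} (ha : a ≠ 0) (x : ℝ) : (a : ℂ) + x * I ≠ 0 := by
  intro h; apply ha; simpa using congrArg Complex.re h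

lemma integral_twoSidedExp_mul_cexp {c b : ℝ} (hc : c < 0) (hb : 0 < b) (x : ℝ) :
    ∫ y : ℝ, (twoSidedExp c b y : ℂ) * cexp (-(x * y) * I) =
      1 / (b + x * I) - 1 / (c + x * I) := by
  have hint : Integrable (fun y : ℝ => (twoSidedExp c b y : ℂ) * cexp (-(x * y) * I)) := by
    refine (integrable_twoSidedExp hc hb).ofReal.mul_bdd (c := 1) ?_ ?_
    · exact Continuous.aestronglyMeasurable (by fun_prop)
    · refine ae_of_all _ fun y => ?_
      have := Complex.norm_exp_ofReal_mul_I (-(x * y))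
      push_cast at this
      exact this.le
  rw [← integral_add_compl (measurableSet_Iic (a := (0 : ℝ))) hint, compl_Iic]
  have h1 : ∫ y in Iic (0 : ℝ), (twoSidedExp c b y : ℂ) * cexp (-(x * y) * I) =
      ∫ y in Iic (0 : ℝ), cexp (-(c + x * I) * y) := by
    refine setIntegral_congr_fun measurableSet_Iic fun y hy => ?_
    rw [twoSidedExp_of_nonpos (by linarith) hy, Complex.ofReal_exp, ← Complex.exp_add]
    congr 1; push_cast; ring
  have h2 : ∫ y in Ioi (0 : ℝ), (twoSidedExp c b y : ℂ) * cexp (-(x * y) * I) =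
      ∫ y in Ioi (0 : ℝ), cexp (-(b + x * I) * y) := by
    refine setIntegral_congr_fun measurableSet_Ioi fun y hy => ?_
    rw [twoSidedExp_of_nonneg (by linarith) (le_of_lt hy), Complex.ofReal_exp, ← Complex.exp_add]
    congr 1; push_cast; ring
  rw [h1, h2, integral_exp_mul_complex_Iic (by simpa using hc),
    integral_exp_mul_complex_Ioi (by simpa using hb)]
  simp only [ofReal_zero, mul_zero, Complex.exp_zero]
  rw [neg_div_neg_eq, div_neg]
  ring

lemma norm_inv_add_ofReal_mul_I_le {a : ℝ} (ha : a ≠ 0) :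
    ∃ C : ℝ, 0 < C ∧ ∀ x : ℝ, ‖((a : ℂ) + x * I)⁻¹‖ ≤ C * (√(1 + x ^ 2))⁻¹ := by
  -- This choice gives c²(1 + x²) ≤ a² + x².
  set c : ℝ := min |a| 1
  have hc : 0 < c := lt_min (abs_pos.2 ha) one_pos
  refine ⟨c⁻¹, inv_pos.2 hc, fun x => ?_⟩
  have h0 : 0 < √(1 + x ^ 2) := Real.sqrt_pos.2 (by positivity)
  rw [norm_inv, ← mul_inv]
  refine inv_anti₀ (by positivity) ?_
  rw [Complex.norm_add_mul_I]
  apply Real.le_sqrt_of_sq_le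
  rw [mul_pow, Real.sq_sqrt (by positivity)]
  have h1 : c ^ 2 ≤ 1 := by
    have : c ≤ 1 := min_le_right _ _
    nlinarith
  have h2 : c ^ 2 ≤ a ^ 2 := by
    have : c ≤ |a| := min_le_left _ _
    rw [← sq_abs a]; nlinarith
  nlinarith [sq_nonneg x]

lemma norm_inv_mul_inv_le {a b : ℝ} (ha : a ≠ 0) (hb : b ≠ 0) :
    ∃ C : ℝ, 0 < C ∧ ∀ x : ℝ,
      ‖(((a : ℂ) + x * I) * ((b : ℂ) + x * I))⁻¹‖ ≤ C * (1 + x ^ 2)⁻¹ := by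
  obtain ⟨C, hC, h⟩ := norm_inv_add_ofReal_mul_I_le ha
  obtain ⟨C', hC', h'⟩ := norm_inv_add_ofReal_mul_I_le hb
  refine ⟨C * C', by positivity, fun x => ?_⟩
  rw [mul_inv, norm_mul]
  calc _ ≤ (C * (√(1 + x ^ 2))⁻¹) * (C' * (√(1 + x ^ 2))⁻¹) :=
        mul_le_mul (h x) (h' x) (norm_nonneg _) (by positivity)
    _ = C * C' * (√(1 + x ^ 2) * √(1 + x ^ 2))⁻¹ := by rw [mul_inv]; ring
    _ = _ := by rw [Real.mul_self_sqrt (by positivity)]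

/-- A single pole decays only like 1/|x|; the difference of two decays quadratically, which makes
every inversion integral absolutely convergent. -/
lemma one_div_sub_one_div_eq {a b : ℝ} (ha : a ≠ 0) (hb : b ≠ 0) (x : ℝ) :
    1 / ((b : ℂ) + x * I) - 1 / (a + x * I) =
      (a - b) * (((a : ℂ) + x * I) * ((b : ℂ) + x * I))⁻¹ := by
  have hb' := add_ofReal_mul_I_ne_zero hb x
  have ha' := add_ofReal_mul_I_ne_zero ha x
  field_simp; ring

lemma continuous_inv_mul_inv {a b : ℝ} (ha : a ≠ 0) (hb : b ≠ 0) :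
    Continuous fun x : ℝ => (((a : ℂ) + x * I) * ((b : ℂ) + x * I))⁻¹ := by
  refine Continuous.inv₀ (by fun_prop) fun x => ?_
  exact mul_ne_zero (add_ofReal_mul_I_ne_zero ha x) (add_ofReal_mul_I_ne_zero hb x)

lemma integrable_inv_mul_inv {a b : ℝ} (ha : a ≠ 0) (hb : b ≠ 0) :
    Integrable fun x : ℝ => (((a : ℂ) + x * I) * ((b : ℂ) + x * I))⁻¹ := by
  obtain ⟨C, hC, h⟩ := norm_inv_mul_inv_le ha hb
  exact (integrable_inv_one_add_sq.const_mul C).mono'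
    (continuous_inv_mul_inv ha hb).aestronglyMeasurable (ae_of_all _ h)

lemma integrable_cexp_mul_kernel {c b : ℝ} (hc : c ≠ 0) (hb : b ≠ 0) (y : ℝ) :
    Integrable fun x : ℝ => cexp (x * y * I) * (1 / ((b : ℂ) + x * I) - 1 / (c + x * I)) := by
  simp_rw [one_div_sub_one_div_eq hc hb]
  refine ((integrable_inv_mul_inv hc hb).const_mul _).bdd_mul (c := 1) ?_ ?_
  · exact Continuous.aestronglyMeasurable (by fun_prop)
  · refine ae_of_all _ fun x => ?_
    have := Complex.norm_exp_ofReal_mul_I (x * y)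
    push_cast at this
    exact this.le

/-- The kernel is the Fourier transform of the two-sided exponential. Continuity of the latter and
integrability of the former make inversion valid at every `y`, not just almost everywhere. -/
lemma integral_cexp_mul_kernel {c b : ℝ} (hc : c < 0) (hb : 0 < b) (y : ℝ) :
    ∫ x : ℝ, cexp (x * y * I) * (1 / ((b : ℂ) + x * I) - 1 / (c + x * I)) =
      2 * Real.pi * twoSidedExp c b y := by
  set f : ℝ → ℂ := fun y => (twoSidedExp c b y : ℂ) with hf
  have hF : 𝓕 f = fun w : ℝ => 1 / ((b : ℂ) + (2 * Real.pi * w : ℝ) * I) -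
      1 / (c + (2 * Real.pi * w : ℝ) * I) := by
    ext w
    rw [Real.fourier_eq', ← integral_twoSidedExp_mul_cexp hc hb]
    refine integral_congr_ae (ae_of_all _ fun v => ?_)
    simp only [hf, smul_eq_mul]
    rw [mul_comm]
    congr 2
    simp
    ring
  have hK : Integrable fun x : ℝ => 1 / ((b : ℂ) + x * I) - 1 / (c + x * I) := by
    simpa using integrable_cexp_mul_kernel hc.ne hb.ne' 0
  have h2pi : (2 * Real.pi) ≠ 0 := by positivity
  have hFi : Integrable (𝓕 f) := by
    rw [hF]
    exact hK.comp_mul_left' h2pi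
  have hfc : Continuous f := Complex.continuous_ofReal.comp (continuous_twoSidedExp c b)
  have hinv := congrFun (Continuous.fourierInv_fourier_eq hfc
    (integrable_twoSidedExp hc hb).ofReal hFi) y
  -- Rescaling from the e^{2πixy} normalisation of `𝓕` to e^{ixy}.
  have hcomp := Measure.integral_comp_mul_left
    (fun x : ℝ => cexp (x * y * I) * (1 / ((b : ℂ) + x * I) - 1 / (c + x * I))) (2 * Real.pi)
  rw [Real.fourierInv_eq', hF] at hinv
  have hl : ∫ x : ℝ, cexp ((2 * Real.pi * x : ℝ) * y * I) *
      (1 / ((b : ℂ) + (2 * Real.pi * x : ℝ) * I) - 1 / (c + (2 * Real.pi * x : ℝ) * I)) =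
      f y := by
    rw [← hinv]
    refine integral_congr_ae (ae_of_all _ fun v => ?_)
    simp only [smul_eq_mul]
    congr 2
    simp
    ring
  rw [hl, abs_of_pos (by positivity)] at hcomp
  have hfy : (twoSidedExp c b y : ℂ) = f y := rfl
  rw [hfy, hcomp, Complex.real_smul]
  have h2pi' : (2 * Real.pi : ℂ) ≠ 0 := by exact_mod_cast h2pi
  push_cast
  rw [← mul_assoc, mul_inv_cancel₀ h2pi', one_mul]

/-- An integral over the line of a function with `g (-x) = conj (g x)` is twice the integral of the
real part over the half line. -/
lemma integral_Ioi_re_of_conj {g : ℝ → ℂ} (hg : Integrable g)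
    (hconj : ∀ x, g (-x) = (starRingEnd ℂ) (g x)) :
    2 * ∫ x in Ioi (0 : ℝ), (g x).re = (∫ x, g x).re := by
  have h1 : (∫ x, g x).re = ∫ x, (g x).re := (integral_re hg).symm
  have h3 := integral_add_compl (measurableSet_Iic (a := (0 : ℝ))) hg.re
  have h2 := integral_comp_neg_Iic 0 (fun x => (g x).re)
  simp only [hconj, Complex.conj_re, neg_zero] at h2
  simp only [RCLike.re_to_complex, compl_Iic] at h3
  rw [h1, ← h3, h2]; ring

/-- The real part of `e^{ixy} (1 / (b + ix) - 1 / (c + ix))`. -/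
noncomputable def halfLineKernel (c b y x : ℝ) : ℝ :=
  (cexp (x * y * I) * (1 / ((b : ℂ) + x * I) - 1 / (c + x * I))).re

lemma integrable_halfLineKernel {c b : ℝ} (hc : c ≠ 0) (hb : b ≠ 0) (y : ℝ) :
    Integrable (halfLineKernel c b y) :=
  (integrable_cexp_mul_kernel hc hb y).re

lemma integral_halfLineKernel {c b : ℝ} (hc : c < 0) (hb : 0 < b) (y : ℝ) :
    ∫ x in Ioi (0 : ℝ), halfLineKernel c b y x = Real.pi * twoSidedExp c b y := by
  have h := integral_Ioi_re_of_conj (integrable_cexp_mul_kernel hc.ne hb.ne' y) (fun x => by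
    simp only [map_mul, map_sub, map_div₀, map_one, map_add, ← Complex.exp_conj, Complex.conj_ofReal,
      Complex.conj_I]
    push_cast
    congr 2 <;> ring_nf)
  rw [integral_cexp_mul_kernel hc hb] at h
  have h2 : (2 * (Real.pi : ℂ) * (twoSidedExp c b y : ℂ)).re = 2 * Real.pi * twoSidedExp c b y := by
    rw [show (2 * (Real.pi : ℂ) * (twoSidedExp c b y : ℂ)) =
      ((2 * Real.pi * twoSidedExp c b y : ℝ) : ℂ) by push_cast; ring, Complex.ofReal_re]
  rw [h2] at h
  have : ∫ x in Ioi (0 : ℝ), halfLineKernel c b y x = ∫ x in Ioi (0 : ℝ),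
    (cexp (x * y * I) * (1 / ((b : ℂ) + x * I) - 1 / (c + x * I))).re := rfl
  rw [this]; linarith

/-! ### Fourier representation of the call payoff. -/

/-- The real part of `e^{(z+1)y} / (z (z + 1))` at `z = ε + ix`. -/
noncomputable def payoffKernel (ε y x : ℝ) : ℝ :=
  (cexp (((ε : ℂ) + x * I + 1) * y) / (((ε : ℂ) + x * I) * ((ε : ℂ) + x * I + 1))).re

/-- The payoff `(e^y - 1)⁺` minus the integral of `payoffKernel ε y` over the half line,
divided by `π`. -/
noncomputable def payoffResidue (ε y : ℝ) : ℝ :=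
  if ε < -1 then Real.exp y - 1
  else if ε = -1 then Real.exp y - 1 / 2
  else if ε < 0 then Real.exp y
  else if ε = 0 then 1 / 2 * Real.exp y
  else 0

/-- Partial fractions 1/(z(z+1)) = 1/z - 1/(z+1), with the modulus of the exponential factored out.
-/
lemma payoffKernel_eq {ε : ℝ} (h0 : ε ≠ 0) (h1 : ε ≠ -1) (y x : ℝ) :
    payoffKernel ε y x = -(Real.exp ((1 + ε) * y) * halfLineKernel ε (1 + ε) y x) := by
  have hb : 1 + ε ≠ 0 := fun h => h1 (by linarith)
  rw [payoffKernel, halfLineKernel, ← Complex.re_ofReal_mul, ← Complex.neg_re,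
    one_div_sub_one_div_eq h0 hb]
  congr 1
  rw [show ((ε : ℂ) + x * I + 1) * y = ((1 + ε) * y : ℝ) + x * y * I by push_cast; ring,
    Complex.exp_add, Complex.ofReal_exp]
  push_cast
  rw [div_eq_mul_inv]
  rw [show (ε : ℂ) + x * I + 1 = 1 + ε + x * I by ring]
  ring

/-- When both poles have the same sign the inversion formula does not apply directly; a reference
pole on the other side reduces to two cases where it does. -/
lemma halfLineKernel_sub (c a b y x : ℝ) :
    halfLineKernel c b y x - halfLineKernel c a y x = halfLineKernel a b y x := by
  simp only [halfLineKernel, ← Complex.sub_re]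
  congr 1; ring

/-- The substitution of -1 - z̄ for z exchanges the two poles and conjugates the denominator. It
reduces ε ≤ -1 to ε ≥ 0. -/
lemma payoffKernel_symm (ε y x : ℝ) :
    payoffKernel ε y x = Real.exp y * payoffKernel (-1 - ε) (-y) x := by
  rw [payoffKernel, payoffKernel, ← Complex.re_ofReal_mul, ← Complex.conj_re]
  congr 1
  simp only [map_mul, map_div₀, map_one, map_add, ← Complex.exp_conj, Complex.conj_ofReal,
      Complex.conj_I]
  rw [Complex.ofReal_exp, mul_div_assoc', ← Complex.exp_add]
  congr 1
  · congr 1; push_cast; ring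
  · push_cast; ring

/-- The singular part of 1/(z(z+1)) at x = 0 is purely imaginary, so in the real part it only meets
sin(xy). No principal value is needed. -/
lemma payoffKernel_zero {x : ℝ} (hx : x ≠ 0) (y : ℝ) :
    payoffKernel 0 y x =
      Real.exp y * (Real.sin (x * y) / x - Real.cos (x * y)) * (1 + x ^ 2)⁻¹ := by
  have hx' : (x : ℂ) ≠ 0 := by exact_mod_cast hx
  have hz : (x : ℂ) * I + 1 ≠ 0 := by
    intro h; simpa using congrArg Complex.re h
  have h2 : (1 + (x : ℂ) ^ 2) ≠ 0 := by
    exact_mod_cast (by positivity : (1 + x ^ 2) ≠ 0)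
  have key : cexp ((((0 : ℝ) : ℂ) + x * I + 1) * y) /
      ((((0 : ℝ) : ℂ) + x * I) * (((0 : ℝ) : ℂ) + x * I + 1)) =
      (Real.exp y * (1 + x ^ 2)⁻¹ : ℝ) * (((Real.cos (x * y) : ℝ) + (Real.sin (x * y) : ℝ) * I) *
        (((-1 : ℝ) : ℂ) + (-(1 / x) : ℝ) * I)) := by
    rw [Complex.ofReal_cos, Complex.ofReal_sin, ← Complex.exp_mul_I]
    push_cast
    rw [show ((0 : ℂ) + x * I + 1) * y = y + x * y * I by ring, Complex.exp_add]
    have : (x : ℂ) * I ≠ 0 := mul_ne_zero hx' I_ne_zero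
    rw [zero_add]
    rw [div_eq_iff (mul_ne_zero this hz)]
    field_simp
    have hI : I ^ 2 = -1 := I_sq
    linear_combination (1 + (x : ℂ) ^ 2 + x * I) * hI
  rw [payoffKernel, key, Complex.re_ofReal_mul]
  simp only [Complex.mul_re, Complex.add_re, Complex.add_im, Complex.ofReal_re, Complex.ofReal_im,
    Complex.mul_im, Complex.I_re, Complex.I_im]
  ring

lemma halfLineKernel_neg_one_one (y x : ℝ) :
    halfLineKernel (-1) 1 y x = 2 * Real.cos (x * y) * (1 + x ^ 2)⁻¹ := by
  have hz : (1 : ℂ) + x * I ≠ 0 := by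
    intro h; simpa using congrArg Complex.re h
  have hz' : (-1 : ℂ) + x * I ≠ 0 := by
    intro h; simpa using congrArg Complex.re h
  have h2 : (1 + (x : ℂ) ^ 2) ≠ 0 := by
    exact_mod_cast (by positivity : (1 + x ^ 2) ≠ 0)
  have key : 1 / (((1 : ℝ) : ℂ) + x * I) - 1 / (((-1 : ℝ) : ℂ) + x * I) =
      (2 * (1 + x ^ 2)⁻¹ : ℝ) := by
    push_cast
    field_simp
    have hI : I ^ 2 = -1 := I_sq
    linear_combination (-2 * (x : ℂ) ^ 2) * hI
  rw [halfLineKernel, key, mul_comm, Complex.re_ofReal_mul,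
    show (x : ℂ) * y * I = ((x * y : ℝ) : ℂ) * I by push_cast; ring, Complex.exp_ofReal_mul_I_re]
  ring

lemma integral_cos_mul {x : ℝ} (hx : x ≠ 0) (y : ℝ) :
    ∫ s in (0 : ℝ)..y, Real.cos (x * s) = Real.sin (x * y) / x := by
  rw [intervalIntegral.integral_comp_mul_left _ hx, integral_cos]
  simp [div_eq_inv_mul]

lemma integral_Ioi_cos (y : ℝ) :
    ∫ x in Ioi (0 : ℝ), Real.cos (x * y) * (1 + x ^ 2)⁻¹ = Real.pi / 2 * Real.exp (-|y|) := by
  have h := integral_halfLineKernel (c := -1) (b := 1) (by norm_num) one_pos y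
  simp_rw [halfLineKernel_neg_one_one, mul_assoc] at h
  rw [integral_const_mul] at h
  have h2 : twoSidedExp (-1) 1 y = Real.exp (-|y|) := by
    rw [twoSidedExp]; congr 1
    rcases le_total 0 y with hy | hy
    · rw [abs_of_nonneg hy, min_eq_right] <;> linarith
    · rw [abs_of_nonpos hy, min_eq_left] <;> linarith
  rw [h2] at h; linarith

lemma integrable_cos_mul (y : ℝ) :
    Integrable fun x : ℝ => Real.cos (x * y) * (1 + x ^ 2)⁻¹ := by
  refine integrable_inv_one_add_sq.bdd_mul (c := 1) ?_ (ae_of_all _ fun x => ?_)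
  · exact Continuous.aestronglyMeasurable (by fun_prop)
  · exact Real.abs_cos_le_one _

lemma abs_sin_div_le (y x : ℝ) : |Real.sin (x * y) / x| ≤ |y| := by
  rcases eq_or_ne x 0 with rfl | hx
  · simp
  rw [abs_div, div_le_iff₀ (abs_pos.2 hx)]
  calc |Real.sin (x * y)| ≤ |x * y| := Real.abs_sin_le_abs
    _ = |y| * |x| := by rw [abs_mul, mul_comm]

lemma integrable_sin_div (y : ℝ) :
    Integrable fun x : ℝ => Real.sin (x * y) / x * (1 + x ^ 2)⁻¹ := by
  refine integrable_inv_one_add_sq.bdd_mul (c := |y|) ?_ (ae_of_all _ fun x => ?_)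
  · exact Measurable.aestronglyMeasurable (by fun_prop)
  · exact abs_sin_div_le y x

/-- Write sin(xy)/x as the integral of cos(xs) for s from 0 to y, exchange the integrals and apply
`integral_Ioi_cos`. -/
lemma integral_Ioi_sin_div (y : ℝ) :
    ∫ x in Ioi (0 : ℝ), Real.sin (x * y) / x * (1 + x ^ 2)⁻¹ =
      Real.pi / 2 * ∫ s in (0 : ℝ)..y, Real.exp (-|s|) := by
  have hswap := intervalIntegral_integral_swap (a := 0) (b := y) (μ := volume.restrict (Ioi 0))
    (f := fun (s x : ℝ) => Real.cos (x * s) * (1 + x ^ 2)⁻¹) (by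
      have h : Integrable (fun q : ℝ × ℝ => (1 : ℝ) * (1 + q.2 ^ 2)⁻¹)
          ((volume.restrict (uIoc 0 y)).prod (volume.restrict (Ioi (0 : ℝ)))) :=
        Integrable.mul_prod (f := fun _ : ℝ => (1 : ℝ)) (g := fun x : ℝ => (1 + x ^ 2)⁻¹)
          (by rw [uIoc]; exact integrableOn_const (by simp)) integrable_inv_one_add_sq.integrableOn
      refine h.mono' (Measurable.aestronglyMeasurable (by fun_prop)) (ae_of_all _ fun q => ?_)
      simp only [Function.uncurry, norm_mul]
      gcongr
      · exact Real.abs_cos_le_one _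
      · exact (Real.norm_of_nonneg (by positivity)).le)
  simp_rw [integral_Ioi_cos, intervalIntegral.integral_mul_const] at hswap
  rw [intervalIntegral.integral_const_mul] at hswap
  rw [hswap]
  refine setIntegral_congr_fun measurableSet_Ioi fun x hx => ?_
  rw [integral_cos_mul (ne_of_gt hx)]

lemma integral_exp_neg_abs_of_nonneg {y : ℝ} (hy : 0 ≤ y) :
    ∫ s in (0 : ℝ)..y, Real.exp (-|s|) = 1 - Real.exp (-y) := by
  have : ∫ s in (0 : ℝ)..y, Real.exp (-|s|) = ∫ s in (0 : ℝ)..y, Real.exp (-s) := by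
    refine intervalIntegral.integral_congr fun s hs => ?_
    rw [uIcc_of_le hy] at hs
    rw [abs_of_nonneg hs.1]
  rw [this]
  simp

lemma integral_exp_neg_abs_of_nonpos {y : ℝ} (hy : y ≤ 0) :
    ∫ s in (0 : ℝ)..y, Real.exp (-|s|) = Real.exp y - 1 := by
  have : ∫ s in (0 : ℝ)..y, Real.exp (-|s|) = ∫ s in (0 : ℝ)..y, Real.exp s := by
    refine intervalIntegral.integral_congr fun s hs => ?_
    rw [uIcc_of_ge hy] at hs
    rw [abs_of_nonpos hs.2, neg_neg]
  rw [this]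
  simp

lemma integral_payoffKernel_zero (y : ℝ) :
    1 / Real.pi * ∫ x in Ioi (0 : ℝ), payoffKernel 0 y x =
      max (Real.exp y - 1) 0 - 1 / 2 * Real.exp y := by
  have h : ∫ x in Ioi (0 : ℝ), payoffKernel 0 y x = ∫ x in Ioi (0 : ℝ),
      Real.exp y * (Real.sin (x * y) / x * (1 + x ^ 2)⁻¹ - Real.cos (x * y) * (1 + x ^ 2)⁻¹) := by
    refine setIntegral_congr_fun measurableSet_Ioi fun x hx => ?_
    rw [payoffKernel_zero (ne_of_gt hx)]; ring
  rw [h, integral_const_mul, integral_sub (integrable_sin_div y).integrableOn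
    (integrable_cos_mul y).integrableOn, integral_Ioi_sin_div, integral_Ioi_cos]
  have hpi := Real.pi_ne_zero
  have hexp : Real.exp y * Real.exp (-y) = 1 := by rw [← Real.exp_add]; simp
  rcases le_total 0 y with hy | hy
  · rw [integral_exp_neg_abs_of_nonneg hy, abs_of_nonneg hy, max_eq_left]
    · field_simp
      linear_combination (-2) * hexp
    · linarith [Real.one_le_exp hy]
  · rw [integral_exp_neg_abs_of_nonpos hy, abs_of_nonpos hy, neg_neg, max_eq_right]
    · field_simp
      ring
    · linarith [Real.exp_le_one_iff.2 hy]

lemma integral_payoffKernel_of_neg_one_lt (ε y : ℝ) (hε : -1 < ε) :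
    1 / Real.pi * ∫ x in Ioi (0 : ℝ), payoffKernel ε y x =
      max (Real.exp y - 1) 0 - payoffResidue ε y := by
  have hpi := Real.pi_ne_zero
  rcases lt_trichotomy ε 0 with h | rfl | h
  · rw [payoffResidue, if_neg (by linarith), if_neg (by linarith), if_pos h]
    simp_rw [payoffKernel_eq h.ne hε.ne']
    rw [integral_neg, integral_const_mul, integral_halfLineKernel h (by linarith)]
    -- Both sides are min(e^y, 1).
    have h2 : Real.exp ((1 + ε) * y) * twoSidedExp ε (1 + ε) y =
        Real.exp y - max (Real.exp y - 1) 0 := by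
      rcases le_total 0 y with hy | hy
      · rw [twoSidedExp_of_nonneg (by linarith) hy, ← Real.exp_add, max_eq_left]
        · ring_nf; simp
        · linarith [Real.one_le_exp hy]
      · rw [twoSidedExp_of_nonpos (by linarith) hy, ← Real.exp_add, max_eq_right]
        · ring_nf
        · linarith [Real.exp_le_one_iff.2 hy]
    field_simp
    linear_combination -h2
  · rw [integral_payoffKernel_zero, payoffResidue]
    norm_num
  · rw [payoffResidue, if_neg (by linarith), if_neg (by linarith), if_neg (by linarith),
      if_neg (by linarith)]
    -- Both poles ε and 1 + ε are positive here; -1 serves as the reference pole.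
    have h1 : ∀ x, payoffKernel ε y x = Real.exp ((1 + ε) * y) *
        (halfLineKernel (-1) ε y x - halfLineKernel (-1) (1 + ε) y x) := fun x => by
      rw [payoffKernel_eq h.ne' hε.ne', ← halfLineKernel_sub (-1) ε (1 + ε)]; ring
    simp_rw [h1]
    rw [integral_const_mul, integral_sub
      (integrable_halfLineKernel (by norm_num) (by linarith) y).integrableOn
      (integrable_halfLineKernel (by norm_num) (by linarith) y).integrableOn,
      integral_halfLineKernel (by norm_num) (by linarith),
      integral_halfLineKernel (by norm_num) (by linarith)]
    have h2 : Real.exp ((1 + ε) * y) * (twoSidedExp (-1) ε y - twoSidedExp (-1) (1 + ε) y) =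
        max (Real.exp y - 1) 0 := by
      rcases le_total 0 y with hy | hy
      · rw [twoSidedExp_of_nonneg (by linarith) hy, twoSidedExp_of_nonneg (by linarith) hy,
          mul_sub, ← Real.exp_add, ← Real.exp_add, max_eq_left]
        · ring_nf; simp; ring
        · linarith [Real.one_le_exp hy]
      · rw [twoSidedExp_of_nonpos (by linarith) hy, twoSidedExp_of_nonpos (by linarith) hy,
          max_eq_right]
        · ring
        · linarith [Real.exp_le_one_iff.2 hy]
    field_simp
    linear_combination h2

/-- The Fourier representation of the payoff `(e^y - 1)⁺`. -/
lemma integral_payoffKernel (ε y : ℝ) :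
    1 / Real.pi * ∫ x in Ioi (0 : ℝ), payoffKernel ε y x =
      max (Real.exp y - 1) 0 - payoffResidue ε y := by
  rcases lt_or_ge (-1) ε with h | h
  · exact integral_payoffKernel_of_neg_one_lt ε y h
  simp_rw [payoffKernel_symm ε y]
  have hexp : Real.exp y * Real.exp (-y) = 1 := by rw [← Real.exp_add]; simp
  -- Put–call parity: the left side is (1 - e^y)⁺.
  have hmax : Real.exp y * max (Real.exp (-y) - 1) 0 =
      max (Real.exp y - 1) 0 - Real.exp y + 1 := by
    rcases le_total 0 y with hy | hy
    · rw [max_eq_right, max_eq_left]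
      · ring
      · linarith [Real.one_le_exp hy]
      · linarith [Real.exp_le_one_iff.2 (neg_nonpos.2 hy)]
    · rw [max_eq_left, max_eq_right]
      · linarith
      · linarith [Real.exp_le_one_iff.2 hy]
      · linarith [Real.one_le_exp (neg_nonneg.2 hy)]
  rw [integral_const_mul, mul_left_comm, integral_payoffKernel_of_neg_one_lt _ _ (by linarith),
    mul_sub, hmax]
  rcases h.lt_or_eq with h' | rfl
  · simp only [payoffResidue]
    rw [if_neg (by linarith), if_neg (by linarith), if_neg (by linarith), if_neg (by linarith),
      if_pos h']
    ring
  · simp only [payoffResidue]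
    norm_num
    linear_combination (-1 / 2) * hexp

/-- The weight `|y|` for the exponents at which the pole on the line of integration is
compensated by taking real parts, and `0` otherwise. -/
noncomputable def poleWeight (ε y : ℝ) : ℝ := if ε = 0 ∨ ε = -1 then |y| else 0

lemma abs_payoffKernel_zero_le {x : ℝ} (hx : x ≠ 0) (y : ℝ) :
    |payoffKernel 0 y x| ≤ Real.exp y * (1 + |y|) * (1 + x ^ 2)⁻¹ := by
  rw [payoffKernel_zero hx, abs_mul, abs_mul, abs_of_pos (Real.exp_pos y),
    abs_of_pos (by positivity : (0 : ℝ) < (1 + x ^ 2)⁻¹)]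
  gcongr
  calc _ ≤ |Real.sin (x * y) / x| + |Real.cos (x * y)| := abs_sub _ _
    _ ≤ |y| + 1 := add_le_add (abs_sin_div_le y x) (Real.abs_cos_le_one _)
    _ = _ := add_comm _ _

/-- A majorant of product form in `y` and `x`, as Fubini requires. Away from the poles the
denominator alone gives the decay; on a pole the bound |sin(xy)/x| ≤ |y| costs a linear factor. -/
lemma exists_abs_payoffKernel_le (ε : ℝ) :
    ∃ C : ℝ, ∀ x : ℝ, 0 < x → ∀ y : ℝ, |payoffKernel ε y x| ≤
      Real.exp ((1 + ε) * y) * (1 + poleWeight ε y) * (C * (1 + x ^ 2)⁻¹) := by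
  rcases eq_or_ne ε 0 with rfl | h0
  · refine ⟨1, fun x hx y => ?_⟩
    simpa [poleWeight] using abs_payoffKernel_zero_le hx.ne' y
  rcases eq_or_ne ε (-1) with rfl | h1
  · refine ⟨1, fun x hx y => ?_⟩
    rw [payoffKernel_symm, abs_mul, abs_of_pos (Real.exp_pos y)]
    have := abs_payoffKernel_zero_le hx.ne' (-y)
    have hexp : Real.exp y * Real.exp (-y) = 1 := by rw [← Real.exp_add]; simp
    norm_num [poleWeight] at this ⊢
    calc _ ≤ Real.exp y * (Real.exp (-y) * (1 + |y|) * (1 + x ^ 2)⁻¹) := by gcongr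
      _ = (Real.exp y * Real.exp (-y)) * ((1 + |y|) * (1 + x ^ 2)⁻¹) := by ring
      _ = _ := by rw [hexp, one_mul]
  · have h1' : ε + 1 ≠ 0 := fun h => h1 (by linarith)
    obtain ⟨C, hC, h⟩ := norm_inv_mul_inv_le h0 h1'
    refine ⟨C, fun x hx y => ?_⟩
    rw [payoffKernel, poleWeight, if_neg (by tauto)]
    refine (Complex.abs_re_le_norm _).trans ?_
    rw [div_eq_mul_inv, norm_mul, Complex.norm_exp,
      show (((ε : ℂ) + x * I + 1) * y).re = (1 + ε) * y by
        simp [Complex.mul_re]; left; ring]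
    rw [add_zero, mul_one]
    gcongr
    have := h x
    push_cast at this
    rwa [show (ε : ℂ) + 1 + x * I = ε + x * I + 1 by ring] at this

/-! ### The Fourier pricing formula under a fixed measure. -/

section FourierPricing

variable {S : Type*} [MeasurableSpace S] {μ : Measure S} {W Y : S → ℝ} {F : ℂ → ℂ} {k ε : ℝ}

lemma exp_sub_log (hk : 0 < k) (y : ℝ) : k * Real.exp (y - Real.log k) = Real.exp y := by
  rw [Real.exp_sub, Real.exp_log hk]; field_simp

/-- With z = iζ this is k · k^{-(z+1)} = k^{-z} together with z(z+1) = -ζ(ζ - i). -/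
lemma mul_payoffKernel_sub_log (hk : 0 < k) (y x : ℝ) :
    k * payoffKernel ε (y - Real.log k) x =
      (cexp (-I * ((x : ℂ) - I * ε) * (Real.log k : ℂ)) *
        (cexp (I * ((x : ℂ) - I * ε - I) * y) /
          (-((x : ℂ) - I * ε) * ((x : ℂ) - I * ε - I)))).re := by
  rw [payoffKernel, ← Complex.re_ofReal_mul]
  congr 1
  nth_rewrite 1 [← Real.exp_log hk]
  have hI : I ^ 2 = -1 := I_sq
  rw [Complex.ofReal_exp, mul_div_assoc', mul_div_assoc', ← Complex.exp_add, ← Complex.exp_add]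
  congr 1
  · congr 1
    push_cast
    linear_combination ((y : ℂ) * (ε + 1) - ε * (Real.log k : ℂ)) * hI
  · linear_combination (x ^ 2 + ε * (ε + 1) : ℂ) * hI

lemma measurable_payoffKernel (ε : ℝ) :
    Measurable fun q : ℝ × ℝ => payoffKernel ε q.1 q.2 := by
  unfold payoffKernel
  exact Complex.measurable_re.comp (by fun_prop)

lemma ofReal_mul_cexp_zero (w y : ℝ) : (w : ℂ) * cexp (I * 0 * y) = (w : ℂ) := by simp

lemma ofReal_mul_cexp_neg_I (w y : ℝ) :
    (w : ℂ) * cexp (I * (-I) * y) = ((w * Real.exp y : ℝ) : ℂ) := by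
  have : I * (-I) * (y : ℂ) = y := by linear_combination (-(y : ℂ)) * I_sq
  rw [this]; push_cast; rfl

lemma norm_ofReal_mul_cexp (w y : ℝ) (ζ : ℂ) :
    ‖(w : ℂ) * cexp (I * ζ * y)‖ = ‖w * Real.exp (-ζ.im * y)‖ := by
  rw [norm_mul, Complex.norm_exp, norm_mul, Complex.norm_real, Real.norm_of_nonneg
    (Real.exp_pos _).le]
  simp

lemma integrable_ofReal_mul_cexp (hW : Measurable W) (hY : Measurable Y) {ζ : ℂ}
    (h : Integrable (fun ξ => W ξ * Real.exp (-ζ.im * Y ξ)) μ) :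
    Integrable (fun ξ => (W ξ : ℂ) * cexp (I * ζ * Y ξ)) μ :=
  h.mono (Measurable.aestronglyMeasurable (by fun_prop))
    (ae_of_all _ fun ξ => (norm_ofReal_mul_cexp _ _ _).le)

lemma fourierIntegrand_eq_integral (hW : Measurable W) (hY : Measurable Y) (hk : 0 < k)
    (hF : ∀ ζ : ℂ, ζ.im = -(1 + ε) → F ζ = ∫ ξ, (W ξ : ℂ) * cexp (I * ζ * Y ξ) ∂μ)
    (hint : Integrable (fun ξ => W ξ * Real.exp ((1 + ε) * Y ξ)) μ) (x : ℝ) :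
    fourierIntegrand F k ((x : ℂ) - I * ε) =
      ∫ ξ, W ξ * (k * payoffKernel ε (Y ξ - Real.log k) x) ∂μ := by
  have him : ((x : ℂ) - I * ε - I).im = -(1 + ε) := by simp; ring
  have hi := integrable_ofReal_mul_cexp (μ := μ) hW hY (ζ := (x : ℂ) - I * ε - I)
    (by rwa [him, neg_neg])
  rw [fourierIntegrand, hF _ him, ← integral_div, ← integral_const_mul]
  have h2 := integral_re ((hi.div_const (-((x : ℂ) - I * ε) * ((x : ℂ) - I * ε - I))).const_mul
    (cexp (-I * ((x : ℂ) - I * ε) * (Real.log k : ℂ))))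
  simp only [RCLike.re_to_complex] at h2
  rw [← h2]
  refine integral_congr_ae (ae_of_all _ fun ξ => ?_)
  simp only
  rw [mul_payoffKernel_sub_log hk, ← Complex.re_ofReal_mul]
  congr 1
  ring

lemma integrable_prod_payoffKernel [SFinite μ] (hW : Measurable W) (hY : Measurable Y)
    (hint : Integrable (fun ξ => W ξ * Real.exp ((1 + ε) * Y ξ) * (1 + |Y ξ|)) μ) (l : ℝ) :
    Integrable (Function.uncurry fun (ξ : S) (x : ℝ) => W ξ * (k * payoffKernel ε (Y ξ - l) x))
      (μ.prod (volume.restrict (Ioi 0))) := by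
  obtain ⟨C, hC⟩ := exists_abs_payoffKernel_le ε
  have hA : Integrable (fun ξ => W ξ * Real.exp ((1 + ε) * (Y ξ - l)) *
      (1 + poleWeight ε (Y ξ - l))) μ := by
    have hm : Measurable fun ξ => W ξ * Real.exp ((1 + ε) * (Y ξ - l)) *
        (1 + poleWeight ε (Y ξ - l)) := by
      unfold poleWeight; split_ifs <;> fun_prop
    refine (hint.const_mul (Real.exp (-((1 + ε) * l)) * (1 + |l|))).mono hm.aestronglyMeasurable
      (ae_of_all _ fun ξ => ?_)
    have h1 : 0 ≤ poleWeight ε (Y ξ - l) := by unfold poleWeight; split_ifs <;> positivity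
    have h2 : poleWeight ε (Y ξ - l) ≤ |Y ξ| + |l| := by
      unfold poleWeight; split_ifs
      · exact abs_sub _ _
      · positivity
    have h3 : Real.exp ((1 + ε) * (Y ξ - l)) =
      Real.exp (-((1 + ε) * l)) * Real.exp ((1 + ε) * Y ξ) := by rw [← Real.exp_add]; ring_nf
    simp only [norm_mul, Real.norm_eq_abs, Real.abs_exp, h3]
    rw [abs_of_nonneg (by positivity : 0 ≤ 1 + poleWeight ε (Y ξ - l)),
      abs_of_nonneg (by positivity : 0 ≤ 1 + |Y ξ|), abs_of_nonneg (by positivity : 0 ≤ 1 + |l|)]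
    have h4 : 1 + poleWeight ε (Y ξ - l) ≤ (1 + |l|) * (1 + |Y ξ|) := by
      nlinarith [abs_nonneg l, abs_nonneg (Y ξ), mul_nonneg (abs_nonneg l) (abs_nonneg (Y ξ))]
    calc _ ≤ |W ξ| * (Real.exp (-((1 + ε) * l)) * Real.exp ((1 + ε) * Y ξ)) *
          ((1 + |l|) * (1 + |Y ξ|)) := by gcongr
      _ = _ := by ring
  have hB : Integrable (fun x : ℝ => |k| * (C * (1 + x ^ 2)⁻¹)) (volume.restrict (Ioi 0)) :=
    ((integrable_inv_one_add_sq.const_mul C).const_mul |k|).integrableOn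
  refine (Integrable.mul_prod hA hB).norm.mono' ?_ ?_
  · refine Measurable.aestronglyMeasurable ?_
    have : Measurable fun q : S × ℝ => payoffKernel ε (Y q.1 - l) q.2 :=
      (measurable_payoffKernel ε).comp (f := fun q : S × ℝ => (Y q.1 - l, q.2)) (by fun_prop)
    exact (hW.comp measurable_fst).mul (this.const_mul k)
  · have hpos : ∀ᵐ q : S × ℝ ∂(μ.prod (volume.restrict (Ioi 0))), 0 < q.2 :=
      Measure.quasiMeasurePreserving_snd.ae (ae_restrict_mem measurableSet_Ioi)
    filter_upwards [hpos] with q hq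
    simp only [Function.uncurry, norm_mul, Real.norm_eq_abs, abs_abs]
    have h := hC q.2 hq (Y q.1 - l)
    have h' := h.trans (le_abs_self _)
    simp only [abs_mul] at h' ⊢
    calc _ ≤ |W q.1| * (|k| * (|Real.exp ((1 + ε) * (Y q.1 - l))| *
          |1 + poleWeight ε (Y q.1 - l)| * (|C| * |(1 + q.2 ^ 2)⁻¹|))) := by gcongr
      _ = _ := by ring

/-- In all five cases the residue has the form a e^y - b, so its weighted integral only involves
F(-i) and F(0). -/
lemma integral_payoffResidue (hk : 0 < k) (hW1 : Integrable W μ)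
    (hWY : Integrable (fun ξ => W ξ * Real.exp (Y ξ)) μ)
    (hF0 : F 0 = ∫ ξ, W ξ ∂μ) (hF1 : F (-I) = ∫ ξ, W ξ * Real.exp (Y ξ) ∂μ) :
    Integrable (fun ξ => W ξ * (k * payoffResidue ε (Y ξ - Real.log k))) μ ∧
    ∫ ξ, W ξ * (k * payoffResidue ε (Y ξ - Real.log k)) ∂μ = residueTerm F k ε := by
  have hR0 : (F 0).re = ∫ ξ, W ξ ∂μ := by rw [hF0, ofReal_re]
  have hR1 : (F (-I)).re = ∫ ξ, W ξ * Real.exp (Y ξ) ∂μ := by rw [hF1, ofReal_re]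
  have aux : ∀ a b : ℝ, (∀ y, payoffResidue ε y = a * Real.exp y - b) →
      Integrable (fun ξ => W ξ * (k * payoffResidue ε (Y ξ - Real.log k))) μ ∧
      ∫ ξ, W ξ * (k * payoffResidue ε (Y ξ - Real.log k)) ∂μ =
        a * (F (-I)).re - k * b * (F 0).re := by
    intro a b h
    have h1 : (fun ξ => W ξ * (k * payoffResidue ε (Y ξ - Real.log k))) =
        fun ξ => a * (W ξ * Real.exp (Y ξ)) - k * b * W ξ := by
      ext ξ
      rw [h, ← exp_sub_log hk (Y ξ)]; ring
    rw [h1]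
    refine ⟨(hWY.const_mul a).sub (hW1.const_mul (k * b)), ?_⟩
    rw [integral_sub (hWY.const_mul a) (hW1.const_mul (k * b)), integral_const_mul,
      integral_const_mul, hR0, hR1]
  unfold residueTerm
  split_ifs with h1 h2 h3 h4
  · convert aux 1 1 (fun y => by simp [payoffResidue, h1]) using 2; ring
  · convert aux 1 (1 / 2) (fun y => by simp [payoffResidue, h2]) using 2; ring
  · convert aux 1 0 (fun y => by simp [payoffResidue, h1, h2, h3]) using 2; ring
  · convert aux (1 / 2) 0 (fun y => by simp [payoffResidue, h4]) using 2; ring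
  · convert aux 0 0 (fun y => by simp [payoffResidue, h1, h2, h3, h4]) using 2; ring

/-- Fourier pricing of the payoff `W (e^Y - k)⁺` under the measure `μ`. -/
theorem integral_mul_max_exp_sub [SFinite μ] (hW : Measurable W) (hY : Measurable Y) (hk : 0 < k)
    (hF : ∀ ζ : ℂ, (ζ.im = -(1 + ε) ∨ ζ = 0 ∨ ζ = -I) →
      F ζ = ∫ ξ, (W ξ : ℂ) * cexp (I * ζ * Y ξ) ∂μ)
    (hW1 : Integrable W μ) (hWY : Integrable (fun ξ => W ξ * Real.exp (Y ξ)) μ)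
    (hint : Integrable (fun ξ => W ξ * Real.exp ((1 + ε) * Y ξ) * (1 + |Y ξ|)) μ) :
    (F 0).im = 0 ∧ (F (-I)).im = 0 ∧
    IntegrableOn (fun x : ℝ => fourierIntegrand F k ((x : ℂ) - I * ε)) (Ioi 0) ∧
    ∫ ξ, W ξ * max (Real.exp (Y ξ) - k) 0 ∂μ = residueTerm F k ε +
      1 / Real.pi * ∫ x in Ioi (0 : ℝ), fourierIntegrand F k ((x : ℂ) - I * ε) := by
  have hF0 : F 0 = ∫ ξ, W ξ ∂μ := by
    rw [hF 0 (by simp)]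
    simp_rw [ofReal_mul_cexp_zero]
    exact integral_ofReal
  have hF1 : F (-I) = ∫ ξ, W ξ * Real.exp (Y ξ) ∂μ := by
    rw [hF (-I) (by simp)]
    simp_rw [ofReal_mul_cexp_neg_I]
    exact integral_ofReal
  have hint' : Integrable (fun ξ => W ξ * Real.exp ((1 + ε) * Y ξ)) μ := by
    refine hint.mono (Measurable.aestronglyMeasurable (by fun_prop)) (ae_of_all _ fun ξ => ?_)
    simp only [norm_mul, Real.norm_eq_abs, abs_of_nonneg (by positivity : 0 ≤ 1 + |Y ξ|)]
    exact le_mul_of_one_le_right (by positivity) (by linarith [abs_nonneg (Y ξ)])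
  have hprod := integrable_prod_payoffKernel (k := k) hW hY hint (Real.log k)
  have hG : (fun x : ℝ => fourierIntegrand F k ((x : ℂ) - I * ε)) =
      fun x => ∫ ξ, W ξ * (k * payoffKernel ε (Y ξ - Real.log k) x) ∂μ :=
    funext fun x => fourierIntegrand_eq_integral hW hY hk (fun ζ h => hF ζ (Or.inl h)) hint' x
  obtain ⟨hres, hres'⟩ := integral_payoffResidue (ε := ε) hk hW1 hWY hF0 hF1
  refine ⟨by rw [hF0, ofReal_im], by rw [hF1, ofReal_im], ?_, ?_⟩
  · rw [hG]
    exact hprod.integral_prod_right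
  · have hI : Integrable (fun ξ => 1 / Real.pi * ∫ x in Ioi (0 : ℝ),
        W ξ * (k * payoffKernel ε (Y ξ - Real.log k) x)) μ := hprod.integral_prod_left.const_mul _
    rw [hG, ← integral_integral_swap hprod, ← hres', ← integral_const_mul, ← integral_add hres hI]
    refine integral_congr_ae (ae_of_all _ fun ξ => ?_)
    simp only
    rw [integral_const_mul, integral_const_mul]
    have h := integral_payoffKernel ε (Y ξ - Real.log k)
    have h2 : max (Real.exp (Y ξ) - k) 0 = k * max (Real.exp (Y ξ - Real.log k) - 1) 0 := by
      rw [mul_max_of_nonneg _ _ hk.le, mul_sub, exp_sub_log hk, mul_one, mul_zero]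
    rw [h2]
    linear_combination (-(W ξ * k)) * h

/-- The logarithmic weight in `integral_mul_max_exp_sub` is dominated by neighbouring exponents. -/
lemma integrable_mul_exp_mul_one_add_abs (hW : Measurable W) (hY : Measurable Y) {a : ℝ}
    (h : ∀ᶠ b in 𝓝 a, Integrable (fun ξ => W ξ * Real.exp (b * Y ξ)) μ) :
    Integrable (fun ξ => W ξ * Real.exp (a * Y ξ) * (1 + |Y ξ|)) μ := by
  obtain ⟨r, hr, h⟩ := Metric.eventually_nhds_iff.1 h
  -- The cap at 1 gives η(1 + |y|) ≤ 1 + η|y| ≤ e^{η|y|}, which is at most e^{ηy} + e^{-ηy}; the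
  -- bound r/2 keeps a ± η inside the ball.
  set η := min (r / 2) 1
  have hη : 0 < η := by positivity
  have hη1 : η ≤ 1 := min_le_right _ _
  have hηr : η < r := (min_le_left _ _).trans_lt (by linarith)
  have h1 := h (y := a + η) (by rw [Real.dist_eq]; simpa [abs_of_pos hη] using hηr)
  have h2 := h (y := a - η) (by rw [Real.dist_eq]; simpa [abs_of_pos hη] using hηr)
  refine ((h1.norm.add h2.norm).const_mul η⁻¹).mono'
    (Measurable.aestronglyMeasurable (by fun_prop)) (ae_of_all _ fun ξ => ?_)
  simp only [norm_mul, Real.norm_eq_abs, Real.abs_exp, Pi.add_apply,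
    abs_of_nonneg (by positivity : 0 ≤ 1 + |Y ξ|)]
  have e1 : Real.exp ((a + η) * Y ξ) = Real.exp (a * Y ξ) * Real.exp (η * Y ξ) := by
    rw [← Real.exp_add]; ring_nf
  have e2 : Real.exp ((a - η) * Y ξ) = Real.exp (a * Y ξ) * Real.exp (-(η * Y ξ)) := by
    rw [← Real.exp_add]; ring_nf
  have key : η * (1 + |Y ξ|) ≤ Real.exp (η * Y ξ) + Real.exp (-(η * Y ξ)) := by
    have p1 := Real.exp_pos (η * Y ξ)
    have p2 := Real.exp_pos (-(η * Y ξ))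
    have q1 := Real.add_one_le_exp (η * Y ξ)
    have q2 := Real.add_one_le_exp (-(η * Y ξ))
    rcases abs_cases (Y ξ) with ⟨h, _⟩ | ⟨h, _⟩ <;> rw [h] <;> nlinarith
  rw [e1, e2]
  calc _ = η⁻¹ * (|W ξ| * Real.exp (a * Y ξ)) * (η * (1 + |Y ξ|)) := by field_simp
    _ ≤ η⁻¹ * (|W ξ| * Real.exp (a * Y ξ)) * (Real.exp (η * Y ξ) + Real.exp (-(η * Y ξ))) := by
      gcongr
    _ = _ := by ring

end FourierPricing

end MultiCurve

namespace MultiCurve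

set_option linter.unusedSectionVars false

open Set
open scoped ENNReal

/-! ### The Markov property for integrable functions. -/

section MarkovProperty

variable {Ω : Type*} {mΩ : MeasurableSpace Ω} {Q : Measure Ω} [IsProbabilityMeasure Q]
  {H : ℝ≥0} {ℱ : Filtration ℝ≥0 mΩ}
  {V : Type*} [NormedAddCommGroup V] [InnerProductSpace ℝ V] [MeasurableSpace V]
  {D : Set V} {X : ℝ≥0 → Ω → D} {p : ℝ≥0 → Kernel D D} {x₀ : D}

namespace IsMarkovProcess

lemma measurable (hX : IsMarkovProcess H ℱ Q X p x₀) {t : ℝ≥0} (ht : t ≤ H) :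
    Measurable (X t) :=
  (hX.adapted t ht).mono (ℱ.le t) le_rfl

/-- The Markov property, assumed for events, becomes an identity of measures on each `A` in `ℱ s`,
so it transfers to all integrals at once. -/
lemma map_restrict_add (hX : IsMarkovProcess H ℱ Q X p x₀) {s t : ℝ≥0} (hst : s + t ≤ H)
    {A : Set Ω} (hA : MeasurableSet[ℱ s] A) :
    (Q.restrict A).map (X (s + t)) = ((Q.restrict A).map (X s)).bind (p t) := by
  have hs : s ≤ H := le_self_add.trans hst
  have ht : t ≤ H := le_add_self.trans hst
  have := hX.conservative t ht
  ext C hC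
  have hXs := hX.measurable hs
  have hXst := hX.measurable hst
  have hpre : MeasurableSet (X (s + t) ⁻¹' C) := hXst hC
  have hind : Integrable ((X (s + t) ⁻¹' C).indicator (fun _ => (1 : ℝ))) Q :=
    (integrable_const 1).indicator hpre
  have hm := hX.markov s t hst C hC
  have h1 := setIntegral_condExp (ℱ.le s) hind hA
  rw [setIntegral_congr_ae (ℱ.le s A hA) (hm.mono fun ω h _ => h), integral_indicator_const _ hpre,
    smul_eq_mul, mul_one] at h1
  rw [Measure.map_apply hXst hC, Measure.bind_apply hC (p t).aemeasurable,
    lintegral_map ((p t).measurable_coe hC) hXs]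
  have h2 : ∫⁻ ω in A, p t (X s ω) C ∂Q = ∫⁻ ω in A, ENNReal.ofReal ((p t (X s ω)).real C) ∂Q := by
    refine lintegral_congr fun ω => ?_
    rw [ofReal_measureReal]
  have hint : Integrable (fun ω => (p t (X s ω)).real C) Q := integrable_condExp.congr hm
  rw [h2, ← ofReal_integral_eq_lintegral_ofReal hint.integrableOn
    (ae_of_all _ fun _ => measureReal_nonneg), h1, ofReal_measureReal]

lemma map_eq (hX : IsMarkovProcess H ℱ Q X p x₀) {t : ℝ≥0} (ht : t ≤ H) :
    Q.map (X t) = p t x₀ := by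
  have h := hX.map_restrict_add (s := 0) (t := t) (by simpa using ht) MeasurableSet.univ
  rw [Measure.restrict_univ, zero_add, Measure.map_congr hX.initial, Measure.map_const,
    measure_univ, one_smul, Measure.dirac_bind (p t).measurable] at h
  exact h

/-- The Markov property for integrable functions of the state. -/
lemma condExp_comp (hX : IsMarkovProcess H ℱ Q X p x₀) {E : Type*} [NormedAddCommGroup E]
    [NormedSpace ℝ E] [CompleteSpace E] {s t : ℝ≥0} (hst : s + t ≤ H) {g : D → E}
    (hg : StronglyMeasurable g) (hint : Integrable (fun ω => g (X (s + t) ω)) Q) :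
    Q[fun ω => g (X (s + t) ω) | ℱ s] =ᵐ[Q] fun ω => ∫ ξ, g ξ ∂(p t (X s ω)) := by
  have hs : s ≤ H := le_self_add.trans hst
  have ht : t ≤ H := le_add_self.trans hst
  have := hX.conservative t ht
  have hXs := hX.measurable hs
  have hXst := hX.measurable hst
  have key : ∀ A : Set Ω, MeasurableSet[ℱ s] A →
      IntegrableOn (fun ω => ∫ ξ, g ξ ∂(p t (X s ω))) A Q ∧
      ∫ ω in A, ∫ ξ, g ξ ∂(p t (X s ω)) ∂Q = ∫ ω in A, g (X (s + t) ω) ∂Q := by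
    intro A hA
    have hmap := hX.map_restrict_add hst hA
    have h1 : Integrable g ((Q.restrict A).map (X (s + t))) :=
      (integrable_map_measure hg.aestronglyMeasurable hXst.aemeasurable).2 hint.integrableOn
    have h2 := integral_map (μ := Q.restrict A) hXst.aemeasurable hg.aestronglyMeasurable (f := g)
    rw [hmap] at h1 h2
    -- As a composition with a constant kernel, the mixture falls under the Bochner integral formula
    -- for composed kernels.
    have hc : ((Q.restrict A).map (X s)).bind (p t) =
        (p t ∘ₖ Kernel.const Unit ((Q.restrict A).map (X s))) () := by
      rw [Kernel.comp_apply, Kernel.const_apply]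
    have h3 := h1
    rw [hc] at h3
    have h4 : Integrable (fun x => ∫ ξ, g ξ ∂(p t x)) ((Q.restrict A).map (X s)) := by
      simpa using h3.integral_comp
    have h5 := Kernel.integral_comp h3
    rw [← hc, h2, Kernel.const_apply, integral_map hXs.aemeasurable h4.1] at h5
    exact ⟨(integrable_map_measure h4.1 hXs.aemeasurable).1 h4, h5.symm⟩
  refine (ae_eq_condExp_of_forall_setIntegral_eq (ℱ.le s) hint (fun A hA _ => (key A hA).1)
    (fun A hA _ => (key A hA).2) ?_).symm
  have hm : StronglyMeasurable fun x => ∫ ξ, g ξ ∂(p t x) := hg.integral_kernel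
  exact (hm.comp_measurable (hX.adapted s hs)).aestronglyMeasurable

end IsMarkovProcess

end MarkovProperty

/-! ### Propagation of exponential moments in space and backwards in time. -/

section ExponentialMoments

variable {V : Type*} [NormedAddCommGroup V] [InnerProductSpace ℝ V]

lemma CVec.norm_exp_pair (a : CVec V) (x : V) :
    ‖Complex.exp (a.pair x)‖ = Real.exp (inner ℝ a.re x) := by
  rw [Complex.norm_exp]; simp [CVec.pair]

variable [MeasurableSpace V] {D : Set V}

/-- The exponential moment `∫ e^{⟨y, ξ⟩} μ(dξ)`, possibly infinite, of a measure on `D`. -/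
noncomputable def expMoment (y : V) (μ : Measure D) : ℝ≥0∞ :=
  ∫⁻ ξ, ENNReal.ofReal (Real.exp (inner ℝ y (ξ : V))) ∂μ

variable [BorelSpace V] [FiniteDimensional ℝ V]

@[fun_prop]
lemma measurable_inner_coe (y : V) : Measurable fun ξ : D => (inner ℝ y (ξ : V) : ℝ) :=
  (Continuous.measurable (by fun_prop : Continuous fun x : V => (inner ℝ y x : ℝ))).comp
    measurable_subtype_coe

@[fun_prop]
lemma CVec.measurable_pair_coe (a : CVec V) : Measurable fun ξ : D => a.pair (ξ : V) := by
  unfold CVec.pair; fun_prop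

/-- The modulus of e^{⟨a, x⟩} depends only on the real part of `a`, so admissibility is a question
about real moments. -/
lemma integrable_exp_pair_iff {a : CVec V} {μ : Measure D} :
    Integrable (fun ξ : D => Complex.exp (a.pair (ξ : V))) μ ↔ expMoment a.re μ ≠ ⊤ := by
  have hm : AEStronglyMeasurable (fun ξ : D => Complex.exp (a.pair (ξ : V))) μ :=
    Measurable.aestronglyMeasurable (by fun_prop)
  rw [Integrable, and_iff_right hm, hasFiniteIntegral_iff_norm, lt_top_iff_ne_top]
  simp_rw [CVec.norm_exp_pair]
  rfl

variable {Ω : Type*} {mΩ : MeasurableSpace Ω} {Q : Measure Ω} [IsProbabilityMeasure Q]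
  {H : ℝ≥0} {ℱ : Filtration ℝ≥0 mΩ} {X : ℝ≥0 → Ω → D} {p : ℝ≥0 → Kernel D D} {x₀ : D}

lemma IsMarkovProcess.integrable_exp_pair_iff (hX : IsMarkovProcess H ℱ Q X p x₀) {a : CVec V}
    {t : ℝ≥0} (ht : t ≤ H) :
    Integrable (fun ω => Complex.exp (a.pair (X t ω : V))) Q ↔ expMoment a.re (p t x₀) ≠ ⊤ := by
  rw [← MultiCurve.integrable_exp_pair_iff, ← hX.map_eq ht,
    integrable_map_measure (Measurable.aestronglyMeasurable (by fun_prop))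
      (hX.measurable ht).aemeasurable]
  rfl

lemma IsMarkovProcess.mem_expDomain_iff (hX : IsMarkovProcess H ℱ Q X p x₀) {a : CVec V}
    {T : ℝ≥0} (hT : T ≤ H) :
    a ∈ expDomain Q X T ↔ ∀ t ≤ T, expMoment a.re (p t x₀) ≠ ⊤ :=
  forall₂_congr fun _ ht => hX.integrable_exp_pair_iff (ht.trans hT)

lemma expDomain_anti {S T : ℝ≥0} (h : S ≤ T) : expDomain Q X T ⊆ expDomain Q X S :=
  fun _ ha t ht => ha t (ht.trans h)

variable {φ : ℝ≥0 → CVec V → ℂ} {ψ : ℝ≥0 → CVec V → CVec V}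

lemma expMoment_ne_zero (y : V) (μ : Measure D) [NeZero μ] : expMoment y μ ≠ 0 := by
  intro h
  rw [expMoment, lintegral_eq_zero_iff (by fun_prop)] at h
  have : ∀ᵐ ξ ∂μ, False := h.mono fun ξ hξ => by
    simp only [Pi.zero_apply, ENNReal.ofReal_eq_zero] at hξ
    exact absurd (Real.exp_pos _) (not_lt.2 hξ)
  rw [eventually_const] at this
  exact this

namespace IsAffineProcess

/-- Purely imaginary arguments are always admissible, so the affine formula gives the whole
characteristic function. -/
lemma charFun_map (hX : IsAffineProcess H ℱ Q X p x₀ φ ψ) {s : ℝ≥0} (hs : s ≤ H) (x : D) (w : V) :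
    charFun ((p s x).map ((↑) : D → V)) w =
      Complex.exp (φ s ⟨0, w⟩ + (ψ s ⟨0, w⟩).pair (x : V)) := by
  have hmem : (⟨0, w⟩ : CVec V) ∈ expDomain Q X s := by
    rw [hX.mem_expDomain_iff hs]
    intro t ht
    have := hX.conservative t (ht.trans hs)
    simp [expMoment]
  rw [← (hX.affine s hs _ hmem x).2, charFun_apply,
    integral_map (measurable_subtype_coe.aemeasurable)
      (Continuous.aestronglyMeasurable (by fun_prop))]
  refine integral_congr_ae (ae_of_all _ fun ξ => ?_)
  simp only [CVec.pair, inner_zero_left]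
  rw [real_inner_comm]
  congr 1
  push_cast; ring

/-- In a product of two characteristic functions the exponents add, and their sum depends on the
starting points only through a + b. -/
lemma map_conv_map (hX : IsAffineProcess H ℱ Q X p x₀ φ ψ) {s : ℝ≥0} (hs : s ≤ H) {a b c d : D}
    (h : (a : V) + b = c + d) :
    ((p s a).map ((↑) : D → V)).conv ((p s b).map ((↑) : D → V)) =
      ((p s c).map ((↑) : D → V)).conv ((p s d).map ((↑) : D → V)) := by
  have := hX.conservative s hs
  have hp : ∀ x, IsProbabilityMeasure ((p s x).map ((↑) : D → V)) := fun x =>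
    Measure.isProbabilityMeasure_map measurable_subtype_coe.aemeasurable
  refine Measure.ext_of_charFun (funext fun w => ?_)
  rw [charFun_conv, charFun_conv, hX.charFun_map hs, hX.charFun_map hs, hX.charFun_map hs,
    hX.charFun_map hs, ← Complex.exp_add, ← Complex.exp_add]
  congr 1
  have : (ψ s ⟨0, w⟩).pair (a : V) + (ψ s ⟨0, w⟩).pair (b : V) =
      (ψ s ⟨0, w⟩).pair (c : V) + (ψ s ⟨0, w⟩).pair (d : V) := by
    have h1 : ∀ y z : V, (ψ s ⟨0, w⟩).pair y + (ψ s ⟨0, w⟩).pair z =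
        (ψ s ⟨0, w⟩).pair (y + z) := fun y z => by
      simp only [CVec.pair, inner_add_right]; push_cast; ring
    rw [h1, h1, h]
  linear_combination this

lemma lintegral_conv_exp {μ ν : Measure D} [SFinite μ] [SFinite ν] (y : V) :
    ∫⁻ x, ENNReal.ofReal (Real.exp (inner ℝ y x))
      ∂((μ.map ((↑) : D → V)).conv (ν.map ((↑) : D → V))) = expMoment y μ * expMoment y ν := by
  have hm : Measurable fun x : V => ENNReal.ofReal (Real.exp (inner ℝ y x)) :=
    ENNReal.measurable_ofReal.comp (Continuous.measurable (by fun_prop))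
  have h : ∀ x : V, ∫⁻ x', ENNReal.ofReal (Real.exp (inner ℝ y (x + x'))) ∂(ν.map ((↑) : D → V)) =
      ENNReal.ofReal (Real.exp (inner ℝ y x)) * expMoment y ν := fun x => by
    refine (lintegral_map (hm.comp (measurable_const_add x)) measurable_subtype_coe).trans ?_
    simp_rw [Function.comp, inner_add_right, Real.exp_add, ENNReal.ofReal_mul (Real.exp_pos _).le]
    rw [lintegral_const_mul _ (by fun_prop)]
    rfl
  rw [Measure.lintegral_conv hm]
  simp_rw [h]
  rw [lintegral_mul_const _ hm, lintegral_map hm measurable_subtype_coe]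
  rfl

/-- The moments satisfy M(a) M(b) = M(c)². As M(b) > 0, an infinite M(a) would make M(c) infinite.
-/
lemma expMoment_ne_top_of_midpoint (hX : IsAffineProcess H ℱ Q X p x₀ φ ψ) {s : ℝ≥0} (hs : s ≤ H)
    {a b c : D} (h : (a : V) + b = c + c) {y : V} (hc : expMoment y (p s c) ≠ ⊤) :
    expMoment y (p s a) ≠ ⊤ := by
  have := hX.conservative s hs
  have h1 : expMoment y (p s a) * expMoment y (p s b) =
      expMoment y (p s c) * expMoment y (p s c) := by
    rw [← lintegral_conv_exp, ← lintegral_conv_exp, hX.map_conv_map hs h]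
  intro hinf
  rw [hinf, ENNReal.top_mul (expMoment_ne_zero y _)] at h1
  exact ENNReal.mul_ne_top hc hc h1.symm

/-- An exponential moment that is finite for one interior starting point is finite for all. -/
lemma expMoment_ne_top_of_interior (hX : IsAffineProcess H ℱ Q X p x₀ φ ψ) (hD : Convex ℝ D)
    {s : ℝ≥0} (hs : s ≤ H) {z : D} (hz : (z : V) ∈ interior D) {y : V}
    (hzy : expMoment y (p s z) ≠ ⊤) (x : D) : expMoment y (p s x) ≠ ⊤ := by
  set v : V := x - z
  have hmem : ∀ n : ℕ, (z : V) + (1 / 2 : ℝ) ^ n • v ∈ D := fun n =>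
    hD.add_smul_sub_mem z.2 x.2 ⟨by positivity, pow_le_one₀ (by norm_num) (by norm_num)⟩
  -- The point z + 2^{-(n+1)} v is the midpoint of z and z + 2^{-n} v.
  have hback : ∀ n : ℕ, expMoment y (p s ⟨_, hmem n⟩) ≠ ⊤ → expMoment y (p s ⟨_, hmem 0⟩) ≠ ⊤ := by
    intro n
    induction n with
    | zero => exact id
    | succ n ih =>
      refine fun h => ih (hX.expMoment_ne_top_of_midpoint hs (b := z) ?_ h)
      simp only [pow_succ]
      module
  have hx : x = ⟨_, hmem 0⟩ := Subtype.ext (by simp [v])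
  have htend : Tendsto (fun n : ℕ => (z : V) - (1 / 2 : ℝ) ^ n • v) atTop (𝓝 (z : V)) := by
    have := (tendsto_pow_atTop_nhds_zero_of_lt_one (r := (1 / 2 : ℝ)) (by norm_num)
      (by norm_num)).smul_const v
    simpa using this.const_sub (z : V)
  -- For large n the reflected point z - 2^{-n} v also lies in `D`, so z itself is the midpoint of
  -- the two points and starts the doubling.
  obtain ⟨n, hn⟩ := (htend.eventually (mem_interior_iff_mem_nhds.1 hz)).exists
  rw [hx]
  refine hback n (hX.expMoment_ne_top_of_midpoint hs (b := ⟨_, hn⟩) ?_ hzy)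
  simp

lemma expMoment_add (hX : IsAffineProcess H ℱ Q X p x₀ φ ψ) {s t : ℝ≥0} (hst : s + t ≤ H) (y : V)
    (x : D) : expMoment y (p (s + t) x) = ∫⁻ η, expMoment y (p t η) ∂(p s x) := by
  rw [hX.chapman_kolmogorov s t hst, expMoment, Kernel.lintegral_comp _ _ _ (by fun_prop)]
  rfl

/-- For small times the process started at an interior point is in the interior of the state
space with positive probability. -/
lemma exists_interior_ne_zero (hX : IsAffineProcess H ℱ Q X p x₀ φ ψ)
    (hx₀ : (x₀ : V) ∈ interior D) :
    ∃ r : ℝ≥0, 0 < r ∧ ∀ s ≤ r, s ≤ H → p s x₀ {ξ : D | (ξ : V) ∈ interior D} ≠ 0 := by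
  obtain ⟨ρ, hρ, hball⟩ := Metric.isOpen_iff.1 isOpen_interior _ hx₀
  -- A tent function equal to 1 at x₀ and zero off the interior of `D`; by weak continuity at time 0
  -- its integral under `p s x₀` stays positive for small `s`.
  let f : BoundedContinuousFunction D ℝ := BoundedContinuousFunction.mkOfBound
    ⟨fun ξ => max (1 - dist (ξ : V) x₀ / ρ) 0, by fun_prop⟩ 1 (fun a b => by
      have h : ∀ c : D, 0 ≤ max (1 - dist (c : V) x₀ / ρ) 0 ∧ max (1 - dist (c : V) x₀ / ρ) 0 ≤ 1 :=
        fun c => ⟨le_max_right _ _, max_le (by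
          have : 0 ≤ dist (c : V) x₀ / ρ := by positivity
          linarith) zero_le_one⟩
      rw [Real.dist_eq, abs_le]
      constructor <;> simp only [ContinuousMap.coe_mk] <;> linarith [h a, h b])
  have hf0 : ∀ ξ : D, (ξ : V) ∉ interior D → f ξ = 0 := by
    intro ξ hξ
    have h1 : ρ ≤ dist (ξ : V) x₀ := by
      by_contra hlt
      exact hξ (hball (Metric.mem_ball.2 (not_le.1 hlt)))
    have h2 : 1 ≤ dist (ξ : V) x₀ / ρ := (one_le_div hρ).2 h1
    exact max_eq_right (by linarith)
  have ht := hX.stochastically_continuous 0 (zero_le) x₀ f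
  have hlim : ∫ ξ, f ξ ∂(p 0 x₀) = 1 := by
    rw [hX.kernel_zero, Kernel.id_apply, integral_dirac]
    change max (1 - dist (x₀ : V) x₀ / ρ) 0 = 1
    simp
  rw [hlim] at ht
  have hev := ht.eventually (lt_mem_nhds (zero_lt_one))
  rw [eventually_nhdsWithin_iff] at hev
  obtain ⟨r, hr, hev⟩ := Metric.eventually_nhds_iff.1 hev
  refine ⟨Real.toNNReal (r / 2), Real.toNNReal_pos.2 (half_pos hr), fun s hs hsH h0 => ?_⟩
  have hsr : (s : ℝ) ≤ r / 2 := by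
    rwa [Real.le_toNNReal_iff_coe_le (half_pos hr).le] at hs
  have hpos := hev (y := s) (by
    rw [NNReal.dist_eq, NNReal.coe_zero, sub_zero, abs_of_nonneg s.coe_nonneg]; linarith) hsH
  have hz : ∫ ξ, f ξ ∂(p s x₀) = 0 := by
    refine integral_eq_zero_of_ae ?_
    have : ∀ᵐ ξ : D ∂(p s x₀), (ξ : V) ∉ interior D := by
      rw [ae_iff]; simpa using h0
    exact this.mono fun ξ hξ => hf0 ξ hξ
  linarith

/-- An exponential moment of an affine process that is finite at time `T` is finite at all
earlier times. -/
theorem expMoment_ne_top_of_le (hX : IsAffineProcess H ℱ Q X p x₀ φ ψ) (hD : Convex ℝ D)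
    (hx₀ : (x₀ : V) ∈ interior D) {T : ℝ≥0} (hT : T ≤ H) {y : V}
    (h : expMoment y (p T x₀) ≠ ⊤) {t : ℝ≥0} (ht : t ≤ T) : expMoment y (p t x₀) ≠ ⊤ := by
  obtain ⟨r, hr, hint⟩ := hX.exists_interior_ne_zero hx₀
  -- By Chapman–Kolmogorov, a finite moment at s + t is finite at time t from almost every state
  -- reached at s. Some such state is interior, and finiteness transfers from it to x₀.
  have hstep : ∀ t s : ℝ≥0, s + t ≤ H → s ≤ r → expMoment y (p (s + t) x₀) ≠ ⊤ →
      expMoment y (p t x₀) ≠ ⊤ := by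
    intro t s hst hsr hfin
    rw [hX.expMoment_add hst] at hfin
    have hm : Measurable fun η => expMoment y (p t η) :=
      Measurable.lintegral_kernel (by fun_prop)
    have hae := ae_lt_top hm hfin
    obtain ⟨η, hη, hη'⟩ : ∃ η : D, (η : V) ∈ interior D ∧ expMoment y (p t η) < ⊤ := by
      by_contra! hcon
      refine hint s hsr (le_self_add.trans hst) (measure_mono_null (fun η hη => ?_) hae)
      exact not_lt.2 (hcon η hη)
    exact hX.expMoment_ne_top_of_interior hD (le_add_self.trans hst) hη hη'.ne x₀
  have hiter : ∀ n : ℕ, ∀ t : ℝ≥0, t ≤ T → T ≤ t + n * r → expMoment y (p t x₀) ≠ ⊤ := by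
    intro n
    induction n with
    | zero =>
      intro t ht hTt
      have : t = T := le_antisymm ht (by simpa using hTt)
      rwa [this]
    | succ n ih =>
      intro t ht hTt
      rcases le_total (r + t) T with hrt | hrt
      · refine hstep t r (hrt.trans hT) le_rfl (ih _ hrt ?_)
        push_cast at hTt
        calc T ≤ _ := hTt
          _ = _ := by ring
      -- Less than one full step remains, so the step is shortened to T - t.
      · have hsub : (T - t) + t = T := tsub_add_cancel_of_le ht
        refine hstep t (T - t) (hsub.le.trans hT) (tsub_le_iff_right.2 hrt) ?_
        rwa [hsub]
  obtain ⟨n, hn⟩ := exists_nat_ge (T / r)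
  refine hiter n t ht ?_
  have : T ≤ n * r := (div_le_iff₀ hr).1 hn
  exact this.trans le_add_self

/-- A complex exponential of an affine process that is integrable at time `T` belongs to `𝔘_T`. -/
theorem mem_expDomain (hX : IsAffineProcess H ℱ Q X p x₀ φ ψ) (hD : Convex ℝ D)
    (hx₀ : (x₀ : V) ∈ interior D) {T : ℝ≥0} (hT : T ≤ H) {a : CVec V}
    (h : Integrable (fun ω => Complex.exp (a.pair (X T ω : V))) Q) : a ∈ expDomain Q X T :=
  (hX.mem_expDomain_iff hT).2 fun _ ht =>
    hX.expMoment_ne_top_of_le hD hx₀ hT ((hX.integrable_exp_pair_iff hT).1 h) ht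

end IsAffineProcess

end ExponentialMoments

/-! ### Exponentials of affine functions of the state. -/

section StateFunctions

variable {V : Type*} [NormedAddCommGroup V] [InnerProductSpace ℝ V]

/-- The exponential `e^{c + ⟨a, x⟩}` of an affine function. -/
noncomputable def expAffine (c : ℝ) (a x : V) : ℝ := Real.exp (c + inner ℝ a x)

/-- The affine function `(c₁ + ⟨a₁, x⟩) - (c₀ + ⟨a₀, x⟩)`. -/
noncomputable def affineDiff (c₀ c₁ : ℝ) (a₀ a₁ x : V) : ℝ :=
  (c₁ + inner ℝ a₁ x) - (c₀ + inner ℝ a₀ x)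

/-- The argument `(1 - iζ) a₀ + iζ a₁` in `V + iV`. -/
noncomputable def interpolate (a₀ a₁ : V) (ζ : ℂ) : CVec V :=
  (1 - Complex.I * ζ) • CVec.ofReal a₀ + (Complex.I * ζ) • CVec.ofReal a₁

lemma CVec.pair_add (a b : CVec V) (x : V) : (a + b).pair x = a.pair x + b.pair x := by
  change (((inner ℝ (a.re + b.re) x : ℝ) : ℂ) + Complex.I * ((inner ℝ (a.im + b.im) x : ℝ) : ℂ)) = _
  simp only [inner_add_left, CVec.pair]; push_cast; ring

lemma CVec.pair_smul (c : ℂ) (a : CVec V) (x : V) : (c • a).pair x = c * a.pair x := by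
  change (((inner ℝ (c.re • a.re - c.im • a.im) x : ℝ) : ℂ) +
    Complex.I * ((inner ℝ (c.re • a.im + c.im • a.re) x : ℝ) : ℂ)) = _
  simp only [inner_add_left, inner_sub_left, real_inner_smul_left, CVec.pair]
  apply Complex.ext <;> simp

lemma CVec.pair_ofReal (a x : V) : (CVec.ofReal a).pair x = ((inner ℝ a x : ℝ) : ℂ) := by
  simp [CVec.pair, CVec.ofReal]

lemma expAffine_mul_cexp_affineDiff (c₀ c₁ : ℝ) (a₀ a₁ x : V) (ζ : ℂ) :
    (expAffine c₀ a₀ x : ℂ) * Complex.exp (Complex.I * ζ * affineDiff c₀ c₁ a₀ a₁ x) =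
      Complex.exp ((1 - Complex.I * ζ) * c₀ + Complex.I * ζ * c₁) *
        Complex.exp ((interpolate a₀ a₁ ζ).pair x) := by
  rw [expAffine, Complex.ofReal_exp, ← Complex.exp_add, ← Complex.exp_add, interpolate,
    CVec.pair_add, CVec.pair_smul, CVec.pair_smul, CVec.pair_ofReal, CVec.pair_ofReal, affineDiff]
  congr 1
  push_cast; ring

variable [MeasurableSpace V] [BorelSpace V] {D : Set V}

@[fun_prop]
lemma measurable_expAffine (c : ℝ) (a : V) : Measurable (expAffine c a) := by
  unfold expAffine; exact Continuous.measurable (by fun_prop)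

@[fun_prop]
lemma measurable_affineDiff (c₀ c₁ : ℝ) (a₀ a₁ : V) : Measurable (affineDiff c₀ c₁ a₀ a₁) := by
  unfold affineDiff; exact Continuous.measurable (by fun_prop)

variable [FiniteDimensional ℝ V]
  {Ω : Type*} {mΩ : MeasurableSpace Ω} {Q : Measure Ω} [IsProbabilityMeasure Q]
  {H : ℝ≥0} {ℱ : Filtration ℝ≥0 mΩ} {X : ℝ≥0 → Ω → D} {p : ℝ≥0 → Kernel D D} {x₀ : D}
  {φ : ℝ≥0 → CVec V → ℂ} {ψ : ℝ≥0 → CVec V → CVec V}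

namespace IsAffineProcess

/-- The exponent `ψ(t, w)` is real for real arguments `w`. -/
lemma psi_ofReal_im (hX : IsAffineProcess H ℱ Q X p x₀ φ ψ) (hx₀ : (x₀ : V) ∈ interior D)
    {t : ℝ≥0} (ht : t ≤ H) {w : V} (hw : CVec.ofReal w ∈ expDomain Q X t) :
    (ψ t (CVec.ofReal w)).im = 0 := by
  set q := (ψ t (CVec.ofReal w)).im with hq
  have hφ := hX.real_exponent t ht w hw
  -- The transform at a real argument is a real integral, so the imaginary part of its exponential
  -- vanishes.
  have hsin : ∀ x : D, Real.sin (inner ℝ q (x : V)) = 0 := by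
    intro x
    have h := (hX.affine t ht _ hw x).2
    simp_rw [CVec.pair_ofReal, ← Complex.ofReal_exp] at h
    rw [integral_complex_ofReal] at h
    have him := congrArg Complex.im h
    rw [Complex.ofReal_im, Complex.exp_im] at him
    have h2 : (φ t (CVec.ofReal w) + (ψ t (CVec.ofReal w)).pair (x : V)).im =
        inner ℝ q (x : V) := by
      simp [CVec.pair, hφ, hq]
    rw [h2] at him
    exact (mul_eq_zero.1 him.symm).resolve_left (Real.exp_pos _).ne'
  by_contra hne
  have hn : 0 < ‖q‖ ^ 2 := by positivity
  -- Moving from x₀ along q by a small h with h‖q‖² < π stays in `D`; the addition formula then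
  -- makes the cosine of ⟨q, x₀⟩ vanish together with its sine.
  have hlim : Tendsto (fun h : ℝ => (x₀ : V) + h • q) (𝓝[>] 0) (𝓝 (x₀ : V)) := by
    have : Tendsto (fun h : ℝ => (x₀ : V) + h • q) (𝓝 0) (𝓝 ((x₀ : V) + (0 : ℝ) • q)) :=
      Continuous.tendsto (by fun_prop) 0
    rw [zero_smul, add_zero] at this
    exact this.mono_left nhdsWithin_le_nhds
  have h1 := hlim.eventually (mem_interior_iff_mem_nhds.1 hx₀)
  have h2 : ∀ᶠ h : ℝ in 𝓝[>] 0, h < Real.pi / ‖q‖ ^ 2 :=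
    nhdsWithin_le_nhds (gt_mem_nhds (by positivity))
  obtain ⟨h, ⟨hD, hlt⟩, hpos⟩ := ((h1.and h2).and self_mem_nhdsWithin).exists
  have e0 := hsin x₀
  have e1 := hsin ⟨_, hD⟩
  simp only [inner_add_right, real_inner_smul_right, real_inner_self_eq_norm_sq] at e1
  rw [Real.sin_add, e0, zero_mul, zero_add] at e1
  have hs : 0 < Real.sin (h * ‖q‖ ^ 2) :=
    Real.sin_pos_of_pos_of_lt_pi (mul_pos hpos hn) ((lt_div_iff₀ hn).1 hlt)
  have hc : Real.cos (inner ℝ q (x₀ : V)) = 0 := (mul_eq_zero.1 e1).resolve_right hs.ne'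
  have := Real.sin_sq_add_cos_sq (inner ℝ q (x₀ : V))
  rw [e0, hc] at this
  norm_num at this

lemma psi_ofReal_eq (hX : IsAffineProcess H ℱ Q X p x₀ φ ψ) (hx₀ : (x₀ : V) ∈ interior D)
    {t : ℝ≥0} (ht : t ≤ H) {w : V} (hw : CVec.ofReal w ∈ expDomain Q X t) :
    ψ t (CVec.ofReal w) = CVec.ofReal (ψ t (CVec.ofReal w)).re := by
  have h := hX.psi_ofReal_im hx₀ ht hw
  rcases hψ : ψ t (CVec.ofReal w) with ⟨a, b⟩
  rw [hψ] at h
  simp only at h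
  rw [h, CVec.ofReal]

lemma integral_exp_inner (hX : IsAffineProcess H ℱ Q X p x₀ φ ψ) (hx₀ : (x₀ : V) ∈ interior D)
    {t : ℝ≥0} (ht : t ≤ H) {w : V} (hw : CVec.ofReal w ∈ expDomain Q X t) (c : ℝ) (x : D) :
    ∫ ξ : D, expAffine c w ξ ∂(p t x) =
      expAffine (c + (φ t (CVec.ofReal w)).re) (ψ t (CVec.ofReal w)).re x := by
  have h := (hX.affine t ht _ hw x).2
  rw [hX.psi_ofReal_eq hx₀ ht hw] at h
  simp_rw [CVec.pair_ofReal, ← Complex.ofReal_exp] at h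
  have hφ : φ t (CVec.ofReal w) = ((φ t (CVec.ofReal w)).re : ℂ) :=
    Complex.ext rfl (hX.real_exponent t ht w hw)
  rw [integral_complex_ofReal, hφ, ← Complex.ofReal_add, ← Complex.ofReal_exp] at h
  have h' := Complex.ofReal_injective h
  simp only [expAffine, Real.exp_add c, integral_const_mul]
  rw [h', add_assoc, Real.exp_add c]

lemma integral_expAffine_mul_cexp (hX : IsAffineProcess H ℱ Q X p x₀ φ ψ) {t : ℝ≥0} (ht : t ≤ H)
    (c₀ c₁ : ℝ) {a₀ a₁ : V} {ζ : ℂ} (h : interpolate a₀ a₁ ζ ∈ expDomain Q X t) (x : D) :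
    Integrable (fun ξ : D => (expAffine c₀ a₀ (ξ : V) : ℂ) *
      Complex.exp (Complex.I * ζ * affineDiff c₀ c₁ a₀ a₁ (ξ : V))) (p t x) ∧
    ∫ ξ : D, (expAffine c₀ a₀ (ξ : V) : ℂ) *
      Complex.exp (Complex.I * ζ * affineDiff c₀ c₁ a₀ a₁ (ξ : V)) ∂(p t x) =
      Complex.exp ((1 - Complex.I * ζ) * c₀ + Complex.I * ζ * c₁) *
        Complex.exp (φ t (interpolate a₀ a₁ ζ)) *
        Complex.exp ((ψ t (interpolate a₀ a₁ ζ)).pair (x : V)) := by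
  obtain ⟨h1, h2⟩ := hX.affine t ht _ h x
  simp_rw [expAffine_mul_cexp_affineDiff]
  refine ⟨h1.const_mul _, ?_⟩
  rw [integral_const_mul, h2, Complex.exp_add (φ t _)]
  exact (mul_assoc _ _ _).symm

/-- Up to a nonzero constant the weighted moment is an exponential moment at time `T`;
`mem_expDomain` supplies the earlier times. -/
lemma interpolate_mem_expDomain (hX : IsAffineProcess H ℱ Q X p x₀ φ ψ) (hD : Convex ℝ D)
    (hx₀ : (x₀ : V) ∈ interior D) {T : ℝ≥0} (hT : T ≤ H) {c₀ c₁ : ℝ} {a₀ a₁ : V} {ζ : ℂ}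
    (h : Integrable (fun ω => expAffine c₀ a₀ (X T ω : V) *
      Real.exp (-ζ.im * affineDiff c₀ c₁ a₀ a₁ (X T ω : V))) Q) :
    interpolate a₀ a₁ ζ ∈ expDomain Q X T := by
  have hXT : Measurable fun ω => (X T ω : V) := measurable_subtype_coe.comp (hX.measurable hT)
  have h1 := integrable_ofReal_mul_cexp ((measurable_expAffine c₀ a₀).comp hXT)
    ((measurable_affineDiff c₀ c₁ a₀ a₁).comp hXT) h
  simp only [Function.comp, expAffine_mul_cexp_affineDiff] at h1
  rw [integrable_const_mul_iff (isUnit_iff_ne_zero.2 (Complex.exp_ne_zero _))] at h1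
  exact hX.mem_expDomain hD hx₀ hT h1

end IsAffineProcess

end StateFunctions

/-! ### Market quantities as functions of the state. -/

section CapletMarket

variable {V : Type*} [NormedAddCommGroup V] [InnerProductSpace ℝ V] [MeasurableSpace V]
  [BorelSpace V] [FiniteDimensional ℝ V] {D : Set V}
  {Ω : Type*} {mΩ : MeasurableSpace Ω} {Q : Measure Ω} [IsProbabilityMeasure Q]
  {H : ℝ≥0} {ℱ : Filtration ℝ≥0 mΩ} {X : ℝ≥0 → Ω → D} {p : ℝ≥0 → Kernel D D} {x₀ : D}
  {φ : ℝ≥0 → CVec V → ℂ} {ψ : ℝ≥0 → CVec V → CVec V}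
  {m : ℕ} {δ : Fin m → ℝ≥0} {M : Market H δ ℱ} {B : ℝ≥0 → Ω → ℝ}
  {u : Fin (m + 1) → ℝ≥0 → V} {v : Fin (m + 1) → ℝ≥0 → ℝ}

namespace Market

lemma IsAffineMultiCurve.numeraire_eq (hB : M.IsNumeraireCouple B Q)
    (hM : M.IsAffineMultiCurve B Q X u v) {t : ℝ≥0} (ht : t ≤ H) :
    ∀ᵐ ω ∂Q, 1 / B t ω = expAffine (v 0 t) (u 0 t) (X t ω : V) := by
  filter_upwards [hM.log_numeraire t ht] with ω h
  rw [expAffine, show v 0 t + inner ℝ (u 0 t) (X t ω : V) = -Real.log (B t ω) by rw [h]; ring,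
    Real.exp_neg, Real.exp_log (hB.pos t ht ω), one_div]

lemma IsNumeraireCouple.integrable_one_div (hB : M.IsNumeraireCouple B Q) {T : ℝ≥0} (hT : T ≤ H) :
    Integrable (fun ω => 1 / B T ω) Q := by
  have h := (hB.bond_martingale T hT).integrable T
  simpa only [min_self, M.bond_maturity T hT] using h

lemma IsNumeraireCouple.condExp_one_div (hB : M.IsNumeraireCouple B Q) {t T : ℝ≥0} (htT : t ≤ T)
    (hT : T ≤ H) :
    Q[fun ω => 1 / B T ω | ℱ t] =ᵐ[Q] fun ω => M.bond t T ω / B t ω := by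
  have h := (hB.bond_martingale T hT).condExp_ae_eq htT
  simpa only [min_self, min_eq_left htT, M.bond_maturity T hT] using h

/-- The discounted bond price as a function of the state. -/
lemma IsAffineMultiCurve.bond_div_eq (hX : IsAffineProcess H ℱ Q X p x₀ φ ψ)
    (hx₀ : (x₀ : V) ∈ interior D) (hB : M.IsNumeraireCouple B Q)
    (hM : M.IsAffineMultiCurve B Q X u v) {T d : ℝ≥0} (hT : T + d ≤ H) :
    ∀ᵐ ω ∂Q, M.bond T (T + d) ω / B T ω =
      expAffine (v 0 (T + d) + (φ d (CVec.ofReal (u 0 (T + d)))).re)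
        (ψ d (CVec.ofReal (u 0 (T + d)))).re (X T ω : V) := by
  have hd : d ≤ H := le_add_self.trans hT
  have hmem : CVec.ofReal (u 0 (T + d)) ∈ expDomain Q X d :=
    expDomain_anti le_add_self (hM.u_zero_mem _ hT)
  have h1 := hB.condExp_one_div (le_self_add : T ≤ T + d) hT
  have h2 := IsAffineMultiCurve.numeraire_eq hB hM hT
  have h3 := hX.condExp_comp hT (g := fun ξ : D => expAffine (v 0 (T + d)) (u 0 (T + d)) (ξ : V))
    (Measurable.stronglyMeasurable (by fun_prop)) ((hB.integrable_one_div hT).congr h2)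
  filter_upwards [h1, h3, condExp_congr_ae (m := ℱ T) h2] with ω e1 e3 e2
  rw [← e1, e2, e3, hX.integral_exp_inner hx₀ hd hmem]

/-- The bond cancels, because 1 + δL^OIS = 1/B(T, T+δ). -/
lemma one_add_mul_xibor_eq {i : Fin m} (hδ : 0 < δ i) {T : ℝ≥0} {ω : Ω}
    (hb : 0 < M.bond T (T + δ i) ω) (hS : 0 < M.spread i T ω) :
    1 + (δ i : ℝ) * M.xibor i T ω = Real.exp (M.logRatio i T ω) := by
  have hδ' : (δ i : ℝ) ≠ 0 := by exact_mod_cast hδ.ne'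
  rw [logRatio, Real.exp_log (div_pos hS hb), spread, oisRate]
  field_simp
  ring_nf

/-- The variable `𝒴_T` as a function of the state. -/
lemma IsAffineMultiCurve.logRatio_eq (hX : IsAffineProcess H ℱ Q X p x₀ φ ψ)
    (hx₀ : (x₀ : V) ∈ interior D) (hδ : ∀ j, 0 < δ j) (hB : M.IsNumeraireCouple B Q)
    (hM : M.IsAffineMultiCurve B Q X u v) {i : Fin m} {T : ℝ≥0} (hT : T + δ i ≤ H) :
    ∀ᵐ ω ∂Q, M.logRatio i T ω =
      affineDiff (v 0 (T + δ i) + (φ (δ i) (CVec.ofReal (u 0 (T + δ i)))).re)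
        (v i.succ T + v 0 T) (ψ (δ i) (CVec.ofReal (u 0 (T + δ i)))).re (u i.succ T + u 0 T)
        (X T ω : V) ∧
      1 + (δ i : ℝ) * M.xibor i T ω = Real.exp (M.logRatio i T ω) := by
  have hTH : T ≤ H := le_self_add.trans hT
  filter_upwards [IsAffineMultiCurve.bond_div_eq hX hx₀ hB hM hT, hM.log_spread i T hT,
    hM.log_numeraire T hTH] with ω e1 e2 e3
  have hBpos := hB.pos T hTH ω
  have hbond : M.bond T (T + δ i) ω = _ * B T ω := (div_eq_iff hBpos.ne').1 e1
  have hbpos : 0 < M.bond T (T + δ i) ω := by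
    rw [hbond]; exact mul_pos (Real.exp_pos _) hBpos
  refine ⟨?_, one_add_mul_xibor_eq (hδ i) hbpos e2.1⟩
  rw [logRatio, Real.log_div e2.1.ne' hbpos.ne', e2.2, hbond, expAffine,
    Real.log_mul (Real.exp_pos _).ne' hBpos.ne', Real.log_exp, e3, affineDiff, inner_add_left]
  ring

/-- The payoff is dominated by the discounted forward rate agreement with strike 1 plus a multiple
of the discounted bond. Any positive strike would serve as reference, so `K` may have any sign. -/
lemma IsNumeraireCouple.integrable_capletPayoff (hB : M.IsNumeraireCouple B Q) {i : Fin m}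
    {T : ℝ≥0} (hT : T + δ i ≤ H) (K : ℝ) : Integrable (M.capletPayoff B i T K) Q := by
  have hTH : T ≤ H := le_self_add.trans hT
  have h1 := (hB.fra_martingale i T 1 hT one_pos).integrable (T + δ i)
  simp only [min_self, M.fra_maturity i T 1 hT] at h1
  have h2 := (hB.integrable_one_div hT).const_mul ((δ i : ℝ) * |1 - K|)
  have hx : Measurable (M.xibor i T) := (M.xibor_adapted i T hT).mono (ℱ.le T) le_rfl
  have hBm : Measurable (B (T + δ i)) := (hB.adapted _ hT).mono (ℱ.le _) le_rfl
  refine (h1.norm.add h2).mono' (Measurable.aestronglyMeasurable ?_) (ae_of_all _ fun ω => ?_)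
  · unfold capletPayoff; fun_prop
  · have hBpos := hB.pos _ hT ω
    have hmax : max (M.xibor i T ω - K) 0 ≤ |M.xibor i T ω - 1| + |1 - K| := by
      refine max_le ?_ (by positivity)
      have := le_abs_self (M.xibor i T ω - 1)
      have := le_abs_self (1 - K)
      linarith
    have h0 : 0 ≤ max (M.xibor i T ω - K) 0 := le_max_right _ _
    simp only [capletPayoff, Pi.add_apply, Real.norm_eq_abs, abs_mul, abs_div, abs_one,
      abs_of_pos hBpos, abs_of_nonneg h0, NNReal.abs_eq]
    calc _ ≤ 1 / B (T + δ i) ω * ((δ i : ℝ) * (|M.xibor i T ω - 1| + |1 - K|)) := by gcongr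
      _ = _ := by ring

/-- The conditional expectation of the discounted caplet payoff at the reset date. -/
lemma IsNumeraireCouple.condExp_capletPayoff (hB : M.IsNumeraireCouple B Q) {i : Fin m}
    {T : ℝ≥0} (hT : T + δ i ≤ H) (K : ℝ) :
    Q[M.capletPayoff B i T K | ℱ T] =ᵐ[Q] fun ω => M.bond T (T + δ i) ω / B T ω *
      max (1 + (δ i : ℝ) * M.xibor i T ω - (1 + (δ i : ℝ) * K)) 0 := by
  have hint := hB.integrable_capletPayoff hT K
  have hx : Measurable[ℱ T] (M.xibor i T) := M.xibor_adapted i T hT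
  have hf : StronglyMeasurable[ℱ T] fun ω => (δ i : ℝ) * max (M.xibor i T ω - K) 0 :=
    Measurable.stronglyMeasurable (by fun_prop)
  have heq : M.capletPayoff B i T K =
      (fun ω => (δ i : ℝ) * max (M.xibor i T ω - K) 0) * fun ω => 1 / B (T + δ i) ω := by
    ext ω; simp only [capletPayoff, Pi.mul_apply]; ring
  rw [heq] at hint ⊢
  -- The payoff is fixed at `T`; only the discount factor at settlement is conditioned.
  filter_upwards [condExp_mul_of_stronglyMeasurable_left hf hint (hB.integrable_one_div hT),
    hB.condExp_one_div (le_self_add : T ≤ T + δ i) hT] with ω e1 e2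
  rw [e1, Pi.mul_apply, e2, mul_max_of_nonneg _ _ (NNReal.coe_nonneg (δ i)), mul_zero,
    add_sub_add_left_eq_sub, ← mul_sub, mul_comm]

end Market

end CapletMarket

end MultiCurve

/-! ### The caplet formula. -/

theorem mainTheorem2
    {Ω : Type*} {mΩ : MeasurableSpace Ω} (Q : Measure Ω) [IsProbabilityMeasure Q]
    (H : ℝ≥0) (ℱ : Filtration ℝ≥0 mΩ)
    {V : Type*} [NormedAddCommGroup V] [InnerProductSpace ℝ V] [FiniteDimensional ℝ V]
    [MeasurableSpace V] [BorelSpace V]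
    (D : Set V) (hD_closed : IsClosed D) (hD_convex : Convex ℝ D)
    (X : ℝ≥0 → Ω → D) (p : ℝ≥0 → Kernel D D) (x₀ : D) (hx₀ : (x₀ : V) ∈ interior D)
    (φ : ℝ≥0 → MultiCurve.CVec V → ℂ) (ψ : ℝ≥0 → MultiCurve.CVec V → MultiCurve.CVec V)
    (hX : MultiCurve.IsAffineProcess H ℱ Q X p x₀ φ ψ)
    {m : ℕ} (δ : Fin m → ℝ≥0) (hδ : ∀ j, 0 < δ j)
    (M : MultiCurve.Market H δ ℱ) (B : ℝ≥0 → Ω → ℝ) (hB : M.IsNumeraireCouple B Q)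
    (u : Fin (m + 1) → ℝ≥0 → V) (v : Fin (m + 1) → ℝ≥0 → ℝ)
    (hM : M.IsAffineMultiCurve B Q X u v)
    (i : Fin m) (t T : ℝ≥0) (htT : t ≤ T) (hT : T + δ i ≤ H)
    (N K ε : ℝ) (hK : 0 < 1 + (δ i : ℝ) * K)
    (hε : 1 + ε ∈ M.momentSet B Q i T) :
    let Kbar : ℝ := 1 + (δ i : ℝ) * K
    let F : Ω → ℂ → ℂ := fun ω ζ =>
      MultiCurve.modifiedMGF φ ψ (u 0) (u i.succ) (v 0) (v i.succ) (δ i) t T (X t ω : V) ζ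
    (∀ ζ : ℂ, (-ζ.im ∈ M.momentSet B Q i T ∨ ζ = 0 ∨ ζ = -Complex.I) →
      Integrable (M.weightedExp B i T ζ) Q ∧
      Q[M.weightedExp B i T ζ | ℱ t] =ᵐ[Q] fun ω => F ω ζ) ∧
    Integrable (M.capletPayoff B i T K) Q ∧
    ∀ᵐ ω ∂Q,
      (F ω 0).im = 0 ∧ (F ω (-Complex.I)).im = 0 ∧
      IntegrableOn (fun x : ℝ => MultiCurve.fourierIntegrand (F ω) Kbar ((x : ℂ) - Complex.I * ε))
        (Set.Ioi 0) ∧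
      M.capletPrice B Q i t T K N ω =
        N * B t ω * (MultiCurve.residueTerm (F ω) Kbar ε +
          1 / Real.pi * ∫ x in Set.Ioi (0 : ℝ),
            MultiCurve.fourierIntegrand (F ω) Kbar ((x : ℂ) - Complex.I * ε)) := by
  intro Kbar F
  have hTH : T ≤ H := le_self_add.trans hT
  have htTT : t + (T - t) = T := add_tsub_cancel_of_le htT
  have htTH : t + (T - t) ≤ H := htTT.le.trans hTH
  have hTtH : T - t ≤ H := tsub_le_self.trans hTH
  have := hX.conservative _ hTtH
  have hmem : MultiCurve.CVec.ofReal (u 0 (T + δ i)) ∈ MultiCurve.expDomain Q X (δ i) :=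
    MultiCurve.expDomain_anti le_add_self (hM.u_zero_mem _ hT)
  set a₀ : V := (ψ (δ i) (MultiCurve.CVec.ofReal (u 0 (T + δ i)))).re
  set a₁ : V := u i.succ T + u 0 T
  set c₀ : ℝ := v 0 (T + δ i) + (φ (δ i) (MultiCurve.CVec.ofReal (u 0 (T + δ i)))).re
  set c₁ : ℝ := v i.succ T + v 0 T
  let W : D → ℝ := fun ξ => MultiCurve.expAffine c₀ a₀ (ξ : V)
  let Y : D → ℝ := fun ξ => MultiCurve.affineDiff c₀ c₁ a₀ a₁ (ξ : V)
  have hW : Measurable W := by fun_prop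
  have hY : Measurable Y := by fun_prop
  have hbond : ∀ᵐ ω ∂Q, M.bond T (T + δ i) ω / B T ω = W (X T ω) := hM.bond_div_eq hX hx₀ hB hT
  have hlog := hM.logRatio_eq hX hx₀ hδ hB hT
  have hadm : ∀ ζ : ℂ, (-ζ.im ∈ M.momentSet B Q i T ∨ ζ = 0 ∨ ζ = -Complex.I) →
      MultiCurve.interpolate a₀ a₁ ζ ∈ MultiCurve.expDomain Q X T := by
    intro ζ hζ
    refine hX.interpolate_mem_expDomain hD_convex hx₀ hTH (c₀ := c₀) (c₁ := c₁) ?_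
    rcases hζ with hζ | rfl | rfl
    · have h : -ζ.im ∈ {ν : ℝ | Integrable (fun ω =>
          M.bond T (T + δ i) ω / B T ω * Real.exp (ν * M.logRatio i T ω)) Q} := interior_subset hζ
      refine Integrable.congr h ?_
      filter_upwards [hbond, hlog] with ω e1 e2
      rw [e1, e2.1]
    -- At ζ = 0 the weight is the discounted bond, integrable by the martingale property.
    · have h := (hB.bond_martingale (T + δ i) hT).integrable T
      simp only [min_eq_left (le_self_add : T ≤ T + δ i)] at h
      refine h.congr ?_
      filter_upwards [hbond] with ω e1
      simpa using e1
    -- At ζ = -i the product W e^Y is e^{c₁ + ⟨a₁, x⟩}, and a₁ is admissible by the model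
    -- assumptions.
    · have h := (hM.u_add_mem i T hTH T le_rfl).norm.const_mul (Real.exp c₁)
      refine h.congr (ae_of_all _ fun ω => ?_)
      simp only [MultiCurve.CVec.norm_exp_pair, MultiCurve.expAffine, MultiCurve.affineDiff,
        ← Real.exp_add, Complex.neg_im, Complex.I_im, neg_neg, one_mul]
      congr 1
      simp only [MultiCurve.CVec.ofReal]
      ring
  -- The affine formula holds from every starting point, so this is valid for every ω. No
  -- exceptional set depends on ζ, and the whole contour can be handled at a fixed ω.
  have hker : ∀ ζ : ℂ, (-ζ.im ∈ M.momentSet B Q i T ∨ ζ = 0 ∨ ζ = -Complex.I) → ∀ ω,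
      Integrable (fun ξ => (W ξ : ℂ) * Complex.exp (Complex.I * ζ * Y ξ)) (p (T - t) (X t ω)) ∧
      F ω ζ = ∫ ξ, (W ξ : ℂ) * Complex.exp (Complex.I * ζ * Y ξ) ∂(p (T - t) (X t ω)) := by
    intro ζ hζ ω
    obtain ⟨h1, h2⟩ := hX.integral_expAffine_mul_cexp hTtH c₀ c₁
      (MultiCurve.expDomain_anti tsub_le_self (hadm ζ hζ)) (X t ω)
    refine ⟨h1, ?_⟩
    rw [h2]
    have hφ : φ (δ i) (MultiCurve.CVec.ofReal (u 0 (T + δ i))) =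
        ((φ (δ i) (MultiCurve.CVec.ofReal (u 0 (T + δ i)))).re : ℂ) :=
      Complex.ext rfl (hX.real_exponent _ (le_add_self.trans hT) _ hmem)
    simp only [F, MultiCurve.modifiedMGF]
    rw [hX.psi_ofReal_eq hx₀ (le_add_self.trans hT) hmem, hφ, ← Complex.ofReal_add]
    rfl
  have hkerR : ∀ ν : ℝ, (ν ∈ M.momentSet B Q i T ∨ ν = 0 ∨ ν = 1) → ∀ ω,
      Integrable (fun ξ => W ξ * Real.exp (ν * Y ξ)) (p (T - t) (X t ω)) := by
    intro ν hν ω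
    have h := (hker (-(Complex.I * ν)) (by
      rcases hν with h | rfl | rfl
      · left; simpa using h
      · right; left; simp
      · right; right; simp) ω).1
    refine h.norm.mono (Measurable.aestronglyMeasurable (by fun_prop)) (ae_of_all _ fun ξ => ?_)
    rw [norm_norm, MultiCurve.norm_ofReal_mul_cexp]
    simp
  have hweighted : ∀ ζ : ℂ, M.weightedExp B i T ζ =ᵐ[Q]
      fun ω => (W (X T ω) : ℂ) * Complex.exp (Complex.I * ζ * Y (X T ω)) := by
    intro ζ
    filter_upwards [hbond, hlog] with ω e1 e2
    rw [MultiCurve.Market.weightedExp, e1, e2.1]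
  refine ⟨fun ζ hζ => ?_, hB.integrable_capletPayoff hT K, ?_⟩
  · have hint : Integrable (fun ω => (W (X T ω) : ℂ) *
        Complex.exp (Complex.I * ζ * Y (X T ω))) Q := by
      simp only [W, Y, MultiCurve.expAffine_mul_cexp_affineDiff]
      exact (hadm ζ hζ T le_rfl).const_mul _
    refine ⟨hint.congr (hweighted ζ).symm, (condExp_congr_ae (hweighted ζ)).trans ?_⟩
    have h := hX.condExp_comp htTH
      (g := fun ξ => (W ξ : ℂ) * Complex.exp (Complex.I * ζ * Y ξ))
      (Measurable.stronglyMeasurable (by fun_prop)) (by rwa [htTT])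
    rw [htTT] at h
    exact h.trans (ae_of_all _ fun ω => (hker ζ hζ ω).2.symm)
  · have hpay : Q[M.capletPayoff B i T K | ℱ T] =ᵐ[Q]
        fun ω => W (X T ω) * max (Real.exp (Y (X T ω)) - Kbar) 0 := by
      filter_upwards [hB.condExp_capletPayoff hT K, hbond, hlog] with ω e1 e2 e3
      rw [e1, e2, e3.2, e3.1]
    have hprice : Q[M.capletPayoff B i T K | ℱ t] =ᵐ[Q]
        fun ω => ∫ ξ, W ξ * max (Real.exp (Y ξ) - Kbar) 0 ∂(p (T - t) (X t ω)) := by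
      have h := hX.condExp_comp htTH (g := fun ξ => W ξ * max (Real.exp (Y ξ) - Kbar) 0)
        (Measurable.stronglyMeasurable (by fun_prop))
        -- Integrability comes from being a version of a conditional expectation.
        (by rw [htTT]; exact integrable_condExp.congr hpay)
      rw [htTT] at h
      exact (condExp_condExp_of_le (ℱ.mono htT) (ℱ.le T)).symm.trans
        ((condExp_congr_ae hpay).trans h)
    filter_upwards [hprice] with ω hω
    obtain ⟨h1, h2, h3, h4⟩ := MultiCurve.integral_mul_max_exp_sub (k := Kbar) (ε := ε) hW hY hK
      (fun ζ hζ => (hker ζ (by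
        rcases hζ with h | h | h
        · left; rwa [h, neg_neg]
        · exact Or.inr (Or.inl h)
        · exact Or.inr (Or.inr h)) ω).2)
      (by simpa using hkerR 0 (by simp) ω) (by simpa using hkerR 1 (by simp) ω)
      -- Openness of the moment set provides the exponents around 1 + ε that absorb the factor 1 +
      -- |Y|.
      (MultiCurve.integrable_mul_exp_mul_one_add_abs hW hY
        ((isOpen_interior.eventually_mem hε).mono fun b hb => hkerR b (Or.inl hb) ω))
    refine ⟨h1, h2, h3, ?_⟩
    rw [MultiCurve.Market.capletPrice, hω, h4]
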